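/- Let $k$ be a field of characteristic $0$, let $n\ge 1$, and let $\omega\in k$ be a primitive $n$-th root of unity. Let $A=T_n$ be the Taft algebra, i.e. the Hopf algebra generated as a $k$-algebra by $x$ and $g$ with relations $$gx=\omega xg,\qquad x^n=0,\qquad g^n=1,$$ with coproduct $\Delta(x)=x\otimes 1+g\otimes x$, $\Delta(g)=g\otimes g$, counit $\varepsilon(x)=0$, $\varepsilon(g)=1$, and antipode $S(x)=-g^{-1}x$, $S(g)=g^{-1}$. Let $H^*(A,k)=\mathrm{Ext}^*_A(k,k)$ be the Hopf algebra cohomology of $A$ and $HH^*(A)=\mathrm{Ext}^*_{A\otimes A^{op}}(A,A)$ its Hochschild cohomology. Let $\iota\colon H^*(A,k)\to HH^*(A)$ be the embedding given by the map $H^*(A,k)\to H^*(A,A^{ad})$ induced by the unit $k\to A$, where $A^{ad}$ is $A$ with the left adjoint action $a\cdot b=\sum a_1bS(a_2)$, followed by the isomorphism $H^*(A,A^{ad})\cong HH^*(A)$. The Gerstenhaber bracket of two elements of $H^*(A,k)$ is the Gerstenhaber bracket in $HH^*(A)$ of their images under $\iota$. Then the Lie structure on $H^*(A,k)$ given by the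 Gerstenhaber bracket is abelian in positive degrees: for all $p,q\ge 1$, all $\alpha\in H^p(A,k)$ and all $\beta\in H^q(A,k)$, $$[\iota(\alpha),\iota(\beta)]=0\quad\text{in } HH^{p+q-1}(A).$$ -/

import Mathlib

open scoped TensorProduct

/-- The `k`-multilinear maps `A ^ n → M`, i.e. the linear maps `A ^ ⊗ n → M`. -/
abbrev BarCochain (k A M : Type*) [Field k] [Ring A] [Algebra k A] [AddCommGroup M] [Module k M]
    (n : ℕ) : Type _ :=
  MultilinearMap k (fun _ : Fin n => A) M

namespace BarCochain

section Differential

variable {k A M : Type*} [Field k] [Ring A] [Algebra k A] [AddCommGroup M] [Module k M]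

/-- Composition of a multilinear map with a substitution of the variables that is linear in each
variable, each variable occurring in one slot only. -/
def slotComp {N n : ℕ} (φ : BarCochain k A M n) (u : (Fin N → A) → Fin n → A)
    (hu : ∀ (a : Fin N → A) (i : Fin N), ∃ (j : Fin n) (l : A →ₗ[k] A), ∀ v,
      u (Function.update a i v) = Function.update (u a) j (l v)) : BarCochain k A M N where
  toFun a := φ (u a)
  map_update_add' := by
    intro inst a i v w
    obtain rfl : inst = instDecidableEqFin N := Subsingleton.elim _ _
    obtain ⟨j, l, h⟩ := hu a i
    simp [h]
  map_update_smul' := by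
    intro inst a i c v
    obtain rfl : inst = instDecidableEqFin N := Subsingleton.elim _ _
    obtain ⟨j, l, h⟩ := hu a i
    simp [h]

@[simp] theorem slotComp_apply {N n : ℕ} (φ : BarCochain k A M n) (u : (Fin N → A) → Fin n → A)
    (hu) (a : Fin N → A) : slotComp φ u hu a = φ (u a) := rfl

/-- `(a₀, …, aₙ) ↦ φ (a₀, …, aⱼ aⱼ₊₁, …, aₙ)`. -/
def face {n : ℕ} (j : Fin n) (φ : BarCochain k A M n) : BarCochain k A M (n + 1) :=
  slotComp φ (fun a => Fin.contractNth j.castSucc (· * ·) a) (by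
    intro a i
    by_cases h1 : (i : ℕ) < j
    · refine ⟨⟨i, by omega⟩, LinearMap.id, fun v => ?_⟩
      funext p
      simp only [Fin.contractNth, Function.update_apply, Fin.ext_iff, Fin.val_castSucc,
        Fin.val_succ, LinearMap.id_apply]
      split_ifs <;> first | rfl | omega
    · by_cases h2 : (i : ℕ) = j
      · refine ⟨j, LinearMap.mulRight k (a j.succ), fun v => ?_⟩
        funext p
        simp only [Fin.contractNth, Function.update_apply, Fin.ext_iff, Fin.val_castSucc,
          Fin.val_succ, LinearMap.mulRight_apply]
        split_ifs with g1 g2 g3 g4 g5 g6 <;> first | rfl | omega | skip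
        all_goals (congr 2; ext; simp; omega)
      · by_cases h3 : (i : ℕ) = j + 1
        · refine ⟨j, LinearMap.mulLeft k (a j.castSucc), fun v => ?_⟩
          funext p
          simp only [Fin.contractNth, Function.update_apply, Fin.ext_iff, Fin.val_castSucc,
            Fin.val_succ, LinearMap.mulLeft_apply]
          split_ifs <;> first | rfl | omega | skip
          all_goals (congr 2; ext; simp; omega)
        · refine ⟨⟨i - 1, by omega⟩, LinearMap.id, fun v => ?_⟩
          funext p
          simp only [Fin.contractNth, Function.update_apply, Fin.ext_iff, Fin.val_castSucc,
            Fin.val_succ, LinearMap.id_apply]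
          split_ifs <;> first | rfl | omega)

/-- `(a₀, …, aₙ) ↦ a₀ φ (a₁, …, aₙ)`, where `A` acts on `M` by `L`. -/
def leftTerm (L : A →ₗ[k] M →ₗ[k] M) {n : ℕ} (φ : BarCochain k A M n) :
    BarCochain k A M (n + 1) :=
  LinearMap.uncurryLeft
    { toFun := fun a => (L a).compMultilinearMap φ
      map_add' := by intros; ext; simp
      map_smul' := by intros; ext; simp }

/-- `(a₀, …, aₙ) ↦ φ (a₀, …, aₙ₋₁) aₙ`, where `A` acts on `M` by `R`. -/
def rightTerm (R : A →ₗ[k] M →ₗ[k] M) {n : ℕ} (φ : BarCochain k A M n) :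
    BarCochain k A M (n + 1) :=
  MultilinearMap.uncurryRight (R.flip.compMultilinearMap φ)

@[simp] theorem face_apply {n : ℕ} (j : Fin n) (φ : BarCochain k A M n) (a : Fin (n + 1) → A) :
    face j φ a = φ (Fin.contractNth j.castSucc (· * ·) a) := rfl

@[simp] theorem leftTerm_apply (L : A →ₗ[k] M →ₗ[k] M) {n : ℕ} (φ : BarCochain k A M n)
    (a : Fin (n + 1) → A) : leftTerm L φ a = L (a 0) (φ (Fin.tail a)) := rfl

@[simp] theorem rightTerm_apply (R : A →ₗ[k] M →ₗ[k] M) {n : ℕ} (φ : BarCochain k A M n)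
    (a : Fin (n + 1) → A) : rightTerm R φ a = R (a (Fin.last n)) (φ (Fin.init a)) := rfl

/-- The bar (Hochschild) differential for a `k`-module `M` on which `A` acts from the left by `L`
and from the right by `R`:
`(dφ)(a₀, …, aₙ) = a₀ φ(a₁, …, aₙ) + ∑ⱼ (-1)ʲ⁺¹ φ(a₀, …, aⱼ aⱼ₊₁, …, aₙ)
  + (-1)ⁿ⁺¹ φ(a₀, …, aₙ₋₁) aₙ`. -/
def d (L R : A →ₗ[k] M →ₗ[k] M) (n : ℕ) : BarCochain k A M n →ₗ[k] BarCochain k A M (n + 1) where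
  toFun φ := leftTerm L φ + ∑ j : Fin n, (-1 : k) ^ (j + 1 : ℕ) • face j φ
    + (-1 : k) ^ (n + 1) • rightTerm R φ
  map_add' φ ψ := by
    ext a
    simp only [add_apply, sum_apply, smul_apply,
      leftTerm_apply, rightTerm_apply, face_apply, map_add, smul_add, Finset.sum_add_distrib]
    abel
  map_smul' c φ := by
    ext a
    simp only [add_apply, sum_apply, smul_apply,
      leftTerm_apply, rightTerm_apply, face_apply, map_smul, smul_add, Finset.smul_sum,
      RingHom.id_apply, smul_comm c]

theorem d_apply (L R : A →ₗ[k] M →ₗ[k] M) {n : ℕ} (φ : BarCochain k A M n)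
    (a : Fin (n + 1) → A) :
    d L R n φ a = L (a 0) (φ (Fin.tail a))
      + ∑ j : Fin n, (-1 : k) ^ (j + 1 : ℕ) • φ (Fin.contractNth j.castSucc (· * ·) a)
      + (-1 : k) ^ (n + 1) • R (a (Fin.last n)) (φ (Fin.init a)) := by
  simp [d, sum_apply]

/-- The `n`-cocycles. -/
def cocycles (L R : A →ₗ[k] M →ₗ[k] M) (n : ℕ) : Submodule k (BarCochain k A M n) :=
  LinearMap.ker (d L R n)

/-- The `n`-coboundaries. -/
def coboundaries (L R : A →ₗ[k] M →ₗ[k] M) : ∀ n : ℕ, Submodule k (BarCochain k A M n)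
  | 0 => ⊥
  | n + 1 => LinearMap.range (d L R n)

/-- The `n`-th cohomology: cocycles modulo coboundaries. -/
abbrev Cohomology (L R : A →ₗ[k] M →ₗ[k] M) (n : ℕ) : Type _ :=
  cocycles L R n ⧸ (coboundaries L R n).comap (cocycles L R n).subtype

end Differential

section Seq

variable {k A M : Type*} [Field k] [Ring A] [Algebra k A] [AddCommGroup M] [Module k M]

/-- A cochain as a function of infinite sequences, reading the first `n` entries. -/
def seq {n : ℕ} (φ : BarCochain k A M n) (a : ℕ → A) : M := φ fun i => a i

theorem ext_seq {n : ℕ} {φ ψ : BarCochain k A M n} (h : ∀ a, φ.seq a = ψ.seq a) : φ = ψ := by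
  ext a
  have := h fun i => if hi : i < n then a ⟨i, hi⟩ else 0
  simpa [seq] using this

/-- Multiply the entries `j` and `j + 1` of a sequence. -/
def faceSeq (j : ℕ) (a : ℕ → A) : ℕ → A := fun p =>
  if p < j then a p else if p = j then a p * a (p + 1) else a (p + 1)

/-- Replace the entries `i, …, i + n - 1` of a sequence by the single entry `v`. -/
def insSeq (i n : ℕ) (v : A) (a : ℕ → A) : ℕ → A := fun p =>
  if p < i then a p else if p = i then v else a (p - 1 + n)

/-- Drop the first `i` entries. -/
def shSeq (i : ℕ) (a : ℕ → A) : ℕ → A := fun p => a (i + p)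

theorem seq_congr {n : ℕ} (φ : BarCochain k A M n) {a b : ℕ → A} (h : ∀ p < n, a p = b p) :
    φ.seq a = φ.seq b := by
  unfold seq
  congr 1
  funext i
  exact h i i.2

theorem d_seq (L R : A →ₗ[k] M →ₗ[k] M) {n : ℕ} (φ : BarCochain k A M n) (a : ℕ → A) :
    (d L R n φ).seq a = L (a 0) (φ.seq (shSeq 1 a))
      + ∑ j ∈ Finset.range n, (-1 : k) ^ (j + 1) • φ.seq (faceSeq j a)
      + (-1 : k) ^ (n + 1) • R (a n) (φ.seq a) := by
  unfold seq
  rw [d_apply, Finset.sum_range]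
  congr 2
  · simp only [Fin.val_zero]
    congr 2
    funext i
    simp [Fin.tail, shSeq, add_comm]

theorem seq_insSeq_add {n : ℕ} (φ : BarCochain k A M n) {i : ℕ} (hi : i < n) (N : ℕ) (v w : A)
    (a : ℕ → A) :
    φ.seq (insSeq i N (v + w) a) = φ.seq (insSeq i N v a) + φ.seq (insSeq i N w a) := by
  have key : ∀ v : A, (fun p : Fin n => insSeq i N v a p)
      = Function.update (fun p : Fin n => insSeq i N 0 a p) ⟨i, hi⟩ v := by
    intro v
    funext p
    simp only [insSeq, Function.update_apply, Fin.ext_iff]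
    split_ifs <;> first | rfl | omega
  unfold seq
  rw [key (v + w), key v, key w, MultilinearMap.map_update_add]

theorem seq_insSeq_smul {n : ℕ} (φ : BarCochain k A M n) {i : ℕ} (hi : i < n) (N : ℕ) (c : k)
    (v : A) (a : ℕ → A) :
    φ.seq (insSeq i N (c • v) a) = c • φ.seq (insSeq i N v a) := by
  have key : ∀ v : A, (fun p : Fin n => insSeq i N v a p)
      = Function.update (fun p : Fin n => insSeq i N 0 a p) ⟨i, hi⟩ v := by
    intro v
    funext p
    simp only [insSeq, Function.update_apply, Fin.ext_iff]
    split_ifs <;> first | rfl | omega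
  unfold seq
  rw [key (c • v), key v, MultilinearMap.map_update_smul]

theorem seq_insSeq_sum {n : ℕ} (φ : BarCochain k A M n) {i : ℕ} (hi : i < n) (N : ℕ)
    {ι : Type*} (s : Finset ι) (v : ι → A) (a : ℕ → A) :
    φ.seq (insSeq i N (∑ l ∈ s, v l) a) = ∑ l ∈ s, φ.seq (insSeq i N (v l) a) := by
  classical
  induction s using Finset.induction_on with
  | empty =>
    have := seq_insSeq_smul φ hi N (0 : k) 0 a
    simpa using this
  | insert x s hx ih => rw [Finset.sum_insert hx, Finset.sum_insert hx, seq_insSeq_add φ hi, ih]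

end Seq

section Circle

variable {k A : Type*} [Field k] [Ring A] [Algebra k A]

/-- The partial composition `f ∘ᵢ g`, i.e.
`(a₀, …, aₘ₊ₙ₋₁) ↦ f (a₀, …, aᵢ₋₁, g (aᵢ, …, aᵢ₊ₙ₋₁), aᵢ₊ₙ, …, aₘ₊ₙ₋₁)`,
of `f` with `m + 1` arguments and `g` with `n` arguments. -/
def insertAt {m n : ℕ} (f : BarCochain k A A (m + 1)) (g : BarCochain k A A n) (i : Fin (m + 1)) :
    BarCochain k A A (m + n) :=
  slotComp f (fun a j =>
      if h : j < i then a ⟨j, by omega⟩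
      else if h' : j = i then g fun l => a ⟨i + l, by omega⟩
      else a ⟨j - 1 + n, by omega⟩) (by
    intro a p
    by_cases h1 : (p : ℕ) < i
    · refine ⟨⟨p, by omega⟩, LinearMap.id, fun v => ?_⟩
      funext j
      simp only [Function.update_apply, Fin.ext_iff, Fin.lt_def, LinearMap.id_apply]
      split_ifs <;> first | rfl | omega | skip
      all_goals (congr 1; funext l; split_ifs <;> first | rfl | omega)
    · by_cases h2 : (p : ℕ) < i + n
      · refine ⟨i, g.toLinearMap (fun l => a ⟨i + l, by omega⟩) ⟨p - i, by omega⟩, fun v => ?_⟩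
        funext j
        simp only [Function.update_apply, Fin.ext_iff, Fin.lt_def, MultilinearMap.toLinearMap_apply]
        split_ifs <;> first | rfl | omega | skip
        all_goals
          congr 1
          funext l
          simp only [Function.update_apply, Fin.ext_iff]
          split_ifs <;> first | rfl | omega
      · refine ⟨⟨p - n + 1, by omega⟩, LinearMap.id, fun v => ?_⟩
        funext j
        simp only [Function.update_apply, Fin.ext_iff, Fin.lt_def, LinearMap.id_apply]
        split_ifs <;> first | rfl | omega | skip
        all_goals (congr 1; funext l; split_ifs <;> first | rfl | omega))

/-- The circle product `f ∘ g = ∑ᵢ (-1) ^ (i (n - 1)) f ∘ᵢ g` of an `(m + 1)`-cochain `f` and an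
`n`-cochain `g`; the sign is written with `n + 1` in place of `n - 1`. -/
def circ {m n : ℕ} (f : BarCochain k A A (m + 1)) (g : BarCochain k A A n) :
    BarCochain k A A (m + n) :=
  ∑ i : Fin (m + 1), (-1 : k) ^ ((i : ℕ) * (n + 1)) • insertAt f g i

theorem insertAt_seq {m n : ℕ} (f : BarCochain k A A (m + 1)) (g : BarCochain k A A n)
    (i : Fin (m + 1)) (a : ℕ → A) :
    (insertAt f g i).seq a = f.seq (insSeq i n (g.seq (shSeq i a)) a) := by
  unfold seq insertAt
  rw [slotComp_apply]
  congr 1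
  funext j
  simp only [insSeq, shSeq, Fin.ext_iff, Fin.lt_def]
  split_ifs <;> rfl

theorem circ_seq {m n : ℕ} (f : BarCochain k A A (m + 1)) (g : BarCochain k A A n) (a : ℕ → A) :
    (circ f g).seq a = ∑ i ∈ Finset.range (m + 1),
      (-1 : k) ^ (i * (n + 1)) • f.seq (insSeq i n (g.seq (shSeq i a)) a) := by
  rw [Finset.sum_range]
  simp only [← insertAt_seq]
  simp [seq, circ, sum_apply]

theorem sum_split {B : Type*} [AddCommMonoid B] (m : ℕ) (h : ℕ → ℕ → B) :
    ∑ i ∈ Finset.range (m + 2), ∑ j ∈ Finset.range (m + 1), h i j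
      = ∑ i ∈ Finset.range (m + 1), ∑ j ∈ Finset.range i, h (i + 1) j
        + ∑ i ∈ Finset.range (m + 1), h (i + 1) i
        + ∑ i ∈ Finset.range (m + 1), h i i
        + ∑ i ∈ Finset.range (m + 1), ∑ t ∈ Finset.range (m - i), h i (i + 1 + t) := by
  have h1 : ∀ i ∈ Finset.range (m + 1), ∑ j ∈ Finset.range (m + 1), h i j
      = ∑ j ∈ Finset.range i, h i j + h i i + ∑ t ∈ Finset.range (m - i), h i (i + 1 + t) := by
    intro i hi
    rw [Finset.mem_range] at hi
    rw [show m + 1 = i + 1 + (m - i) by omega, Finset.sum_range_add, Finset.sum_range_succ]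
  have h2 : ∑ i ∈ Finset.range (m + 2), ∑ j ∈ Finset.range i, h i j
      = ∑ i ∈ Finset.range (m + 1), ∑ j ∈ Finset.range i, h (i + 1) j
        + ∑ i ∈ Finset.range (m + 1), h (i + 1) i := by
    rw [Finset.sum_range_succ', Finset.sum_range_zero, add_zero, ← Finset.sum_add_distrib]
    exact Finset.sum_congr rfl fun i _ => Finset.sum_range_succ _ _
  rw [← h2, Finset.sum_range_succ, Finset.sum_congr rfl h1, Finset.sum_add_distrib,
    Finset.sum_add_distrib, Finset.sum_range_succ _ (m + 1)]
  abel

/-- The Hochschild differential. -/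
abbrev dH (k A : Type*) [Field k] [Ring A] [Algebra k A] (n : ℕ) :
    BarCochain k A A n →ₗ[k] BarCochain k A A (n + 1) :=
  d (LinearMap.mul k A) (LinearMap.mul k A).flip n

theorem dH_seq {n : ℕ} (φ : BarCochain k A A n) (a : ℕ → A) :
    (dH k A n φ).seq a = a 0 * φ.seq (shSeq 1 a)
      + ∑ j ∈ Finset.range n, (-1 : k) ^ (j + 1) • φ.seq (faceSeq j a)
      + (-1 : k) ^ (n + 1) • (φ.seq a * a n) := by
  rw [dH, d_seq]
  rfl

set_option maxHeartbeats 2000000 in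
/-- The failure of the circle product to be a derivation. -/
theorem dH_circ_seq {m n : ℕ} (f : BarCochain k A A (m + 1)) (g : BarCochain k A A n)
    (a : ℕ → A) :
    (dH k A (m + n) (circ f g)).seq a = (circ f (dH k A n g)).seq a
      + (-1 : k) ^ (n + 1) • (circ (dH k A (m + 1) f) g).seq a
      - (-1 : k) ^ (n + 1) • (g.seq a * f.seq (shSeq n a))
      - (-1 : k) ^ (m * n) • (f.seq a * g.seq (shSeq (m + 1) a)) := by
  set s : k := (-1) ^ (n + 1) with hs
  have hs2 : s * s = 1 := by
    rw [hs, ← pow_add, Even.neg_one_pow ⟨n + 1, rfl⟩]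
  have hS : ∀ i : ℕ, (-1 : k) ^ (i * (n + 1)) = s ^ i := fun i => by
    rw [hs, ← pow_mul, mul_comm]
  have hS' : ∀ i : ℕ, (-1 : k) ^ (i * (n + 1 + 1)) = s ^ i * (-1) ^ i := fun i => by
    rw [← hS, ← pow_add]; ring
  set b : ℕ → ℕ → A := fun i => insSeq i n (g.seq (shSeq i a)) a with hb
  set P : ℕ → A := fun i => a 0 * f.seq (insSeq i n (g.seq (shSeq i (shSeq 1 a))) (shSeq 1 a))
    with hP
  set W : ℕ → ℕ → A := fun i j => f.seq (faceSeq j (b i)) with hW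
  set Y : ℕ → ℕ → A := fun i l => f.seq (insSeq i (n + 1) (g.seq (faceSeq l (shSeq i a))) a)
    with hY
  set X : ℕ → A := fun i => f.seq (insSeq i (n + 1) (a i * g.seq (shSeq (i + 1) a)) a) with hX
  set Z : ℕ → A := fun i => f.seq (insSeq i (n + 1) (g.seq (shSeq i a) * a (i + n)) a) with hZ
  set Q : ℕ → A := fun i => f.seq (b i) * a (m + n) with hQ
  set T1 := ∑ i ∈ Finset.range (m + 1), s ^ i • P i with hT1
  set T2 := ∑ i ∈ Finset.range (m + 1), ∑ j ∈ Finset.range i,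
    (s ^ i * (-1) ^ (j + 1)) • W (i + 1) j with hT2
  set T3 := ∑ i ∈ Finset.range (m + 1), ∑ l ∈ Finset.range n,
    (s ^ i * (-1) ^ (i + l + 1)) • Y i l with hT3
  set T4 := ∑ i ∈ Finset.range (m + 1), ∑ t ∈ Finset.range (m - i),
    (s ^ i * (-1) ^ (i + n + t + 1)) • W i (i + 1 + t) with hT4
  set T5 := ∑ i ∈ Finset.range (m + 1), s ^ i • Q i with hT5
  set T6 := ∑ i ∈ Finset.range (m + 1), (s ^ i * (-1) ^ i) • X i with hT6
  set T7 := ∑ i ∈ Finset.range (m + 1), (s ^ i * (-1) ^ i) • Z i with hT7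
  -- identification of the terms
  have v1 : ∀ i j, j < i →
      insSeq i n (g.seq (shSeq i (faceSeq j a))) (faceSeq j a) = faceSeq j (b (i + 1)) := by
    intro i j hij
    have : shSeq i (faceSeq j a) = shSeq (i + 1) a := by
      funext p
      simp only [shSeq, faceSeq]
      split_ifs <;> first | omega | skip
      congr 1; omega
    rw [this]
    funext p
    simp only [hb, insSeq, faceSeq]
    split_ifs <;> first | rfl | omega | (congr 1; omega)
  have v2 : ∀ i l, l < n →
      insSeq i n (g.seq (shSeq i (faceSeq (i + l) a))) (faceSeq (i + l) a)
        = insSeq i (n + 1) (g.seq (faceSeq l (shSeq i a))) a := by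
    intro i l hl
    have : shSeq i (faceSeq (i + l) a) = faceSeq l (shSeq i a) := by
      funext p
      simp only [shSeq, faceSeq]
      split_ifs <;> first | rfl | omega
    rw [this]
    funext p
    simp only [insSeq, faceSeq]
    split_ifs <;> first | rfl | omega
  have v3 : ∀ i t, insSeq i n (g.seq (shSeq i (faceSeq (i + n + t) a))) (faceSeq (i + n + t) a)
        = faceSeq (i + 1 + t) (b i) := by
    intro i t
    have : g.seq (shSeq i (faceSeq (i + n + t) a)) = g.seq (shSeq i a) := by
      apply seq_congr
      intro p hp
      simp only [shSeq, faceSeq]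
      split_ifs <;> first | rfl | omega
    rw [this]
    funext p
    simp only [hb, insSeq, faceSeq]
    split_ifs <;> first | rfl | omega | (congr 1; omega) | (congr 2; omega)
  have v4 : ∀ i, faceSeq i (b (i + 1)) = insSeq i (n + 1) (a i * g.seq (shSeq (i + 1) a)) a := by
    intro i
    funext p
    simp only [hb, insSeq, faceSeq]
    split_ifs <;> first | rfl | omega | (congr 1; omega) | (subst p; rfl)
  have v5 : ∀ i, faceSeq i (b i) = insSeq i (n + 1) (g.seq (shSeq i a) * a (i + n)) a := by
    intro i
    funext p
    simp only [hb, insSeq, faceSeq]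
    split_ifs <;> first | rfl | omega | (congr 1; omega) | (congr 2; omega)
  have hLHS : (dH k A (m + n) (circ f g)).seq a
      = T1 + T2 + T3 + T4 + ((-1) ^ (m + n + 1) : k) • T5 := by
    rw [dH_seq]
    simp only [circ_seq, hS, Finset.mul_sum, Finset.sum_mul, Finset.smul_sum, mul_smul_comm,
      smul_mul_assoc]
    rw [Finset.sum_comm]
    have h1 : ∀ i ∈ Finset.range (m + 1), ∑ j ∈ Finset.range (m + n), (-1 : k) ^ (j + 1) •
          s ^ i • f.seq (insSeq i n (g.seq (shSeq i (faceSeq j a))) (faceSeq j a))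
        = ∑ j ∈ Finset.range i, (s ^ i * (-1) ^ (j + 1)) • W (i + 1) j
          + ∑ l ∈ Finset.range n, (s ^ i * (-1) ^ (i + l + 1)) • Y i l
          + ∑ t ∈ Finset.range (m - i), (s ^ i * (-1) ^ (i + n + t + 1)) • W i (i + 1 + t) := by
      intro i hi
      rw [Finset.mem_range] at hi
      rw [show m + n = i + n + (m - i) by omega, Finset.sum_range_add, Finset.sum_range_add]
      congr 1
      · congr 1
        · refine Finset.sum_congr rfl fun j hj => ?_
          rw [v1 i j (Finset.mem_range.1 hj), smul_smul, mul_comm]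
        · refine Finset.sum_congr rfl fun j hj => ?_
          rw [v2 i j (Finset.mem_range.1 hj), smul_smul, mul_comm]
      · refine Finset.sum_congr rfl fun j hj => ?_
        rw [v3 i j, smul_smul, mul_comm]
    rw [Finset.sum_congr rfl h1, Finset.sum_add_distrib, Finset.sum_add_distrib]
    simp only [hT5, Finset.smul_sum]
    abel
  have hfdg : (circ f (dH k A n g)).seq a = T6 + T3 + s • T7 := by
    rw [circ_seq]
    simp only [hT6, hT3, hT7, Finset.smul_sum]
    rw [← Finset.sum_add_distrib, ← Finset.sum_add_distrib]
    refine Finset.sum_congr rfl fun i hi => ?_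
    have hi' := Finset.mem_range.1 hi
    rw [dH_seq, seq_insSeq_add f hi', seq_insSeq_add f hi', seq_insSeq_sum f hi',
      seq_insSeq_smul f hi', hS']
    simp only [seq_insSeq_smul f hi', smul_add, Finset.smul_sum, smul_smul]
    refine congrArg₂ _ (congrArg₂ _ ?_ ?_) ?_
    · rw [hX]
      have h1 : shSeq 1 (shSeq i a) = shSeq (i + 1) a := by
        funext p
        simp only [shSeq]
        congr 1; omega
      have h2 : shSeq i a 0 = a i := rfl
      rw [h1, h2]
    · refine Finset.sum_congr rfl fun l _ => ?_
      rw [hY]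
      congr 1
      ring
    · rw [mul_comm, hZ]
      rfl
  have hdfg : (circ (dH k A (m + 1) f) g).seq a = g.seq a * f.seq (shSeq n a) + s • T1
      + (s • T2 - s • T6 - T7 + s • T4)
      + ((-1) ^ m : k) • T5 + ((-1) ^ m * s ^ (m + 1) : k) • (f.seq a * g.seq (shSeq (m + 1) a)) := by
    rw [circ_seq]
    simp only [dH_seq, smul_add, Finset.sum_add_distrib, hS]
    have e1 : ∑ i ∈ Finset.range (m + 1 + 1), s ^ i • (b i 0 * f.seq (shSeq 1 (b i)))
        = g.seq a * f.seq (shSeq n a) + s • T1 := by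
      rw [Finset.sum_range_succ', add_comm]
      congr 1
      · rw [pow_zero, one_smul]
        have h1 : b 0 0 = g.seq a := by
          simp only [hb, insSeq, lt_irrefl, if_false, if_true]
          congr 1
          funext p
          simp [shSeq]
        have h2 : shSeq 1 (b 0) = shSeq n a := by
          funext p
          simp only [hb, insSeq, shSeq]
          split_ifs <;> first | omega | (congr 1; omega)
        rw [h1, h2]
      · rw [hT1, Finset.smul_sum]
        refine Finset.sum_congr rfl fun i _ => ?_
        have h1 : b (i + 1) 0 = a 0 := by simp [hb, insSeq]
        have h2 : shSeq 1 (b (i + 1))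
            = insSeq i n (g.seq (shSeq i (shSeq 1 a))) (shSeq 1 a) := by
          have : shSeq i (shSeq 1 a) = shSeq (i + 1) a := by
            funext p
            simp only [shSeq]
            congr 1; omega
          rw [this]
          funext p
          simp only [hb, insSeq, shSeq]
          split_ifs <;> first | rfl | omega | (congr 1; omega)
        rw [h1, h2, smul_smul, pow_succ']
    have e2 : ∑ i ∈ Finset.range (m + 1 + 1), s ^ i • ∑ j ∈ Finset.range (m + 1),
          (-1 : k) ^ (j + 1) • f.seq (faceSeq j (b i))
        = s • T2 - s • T6 - T7 + s • T4 := by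
      simp only [Finset.smul_sum, smul_smul]
      rw [sum_split m fun i j => (s ^ i * (-1) ^ (j + 1)) • f.seq (faceSeq j (b i))]
      have n6 : -(s • T6) = ∑ i ∈ Finset.range (m + 1), (-(s * (s ^ i * (-1) ^ i))) • X i := by
        simp only [hT6, Finset.smul_sum, smul_smul, neg_smul, Finset.sum_neg_distrib]
      have n7 : -T7 = ∑ i ∈ Finset.range (m + 1), (-(s ^ i * (-1) ^ i)) • Z i := by
        simp only [hT7, neg_smul, Finset.sum_neg_distrib]
      rw [sub_eq_add_neg, sub_eq_add_neg, n6, n7]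
      simp only [hT2, hT4, Finset.smul_sum, smul_smul]
      congr 1
      · congr 1
        · congr 1
          · refine Finset.sum_congr rfl fun i _ => Finset.sum_congr rfl fun j _ => ?_
            congr 1
            ring
          · refine Finset.sum_congr rfl fun i _ => ?_
            rw [v4]
            congr 1
            ring
        · refine Finset.sum_congr rfl fun i _ => ?_
          rw [v5]
          congr 1
          ring
      · refine Finset.sum_congr rfl fun i _ => Finset.sum_congr rfl fun t _ => ?_
        have : s * (s ^ i * (-1) ^ (i + n + t + 1)) = s ^ i * (-1) ^ (i + 1 + t + 1) := by
          rw [show i + n + t + 1 = (i + t) + (n + 1) by ring, pow_add _ (i + t), ← hs]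
          linear_combination s ^ i * (-1) ^ (i + t) * hs2
        rw [this]
    have e3 : ∑ i ∈ Finset.range (m + 1 + 1), s ^ i • (-1 : k) ^ (m + 1 + 1) •
          (f.seq (b i) * b i (m + 1))
        = ((-1) ^ m : k) • T5
          + ((-1) ^ m * s ^ (m + 1) : k) • (f.seq a * g.seq (shSeq (m + 1) a)) := by
      rw [Finset.sum_range_succ]
      congr 1
      · rw [hT5, Finset.smul_sum]
        refine Finset.sum_congr rfl fun i hi => ?_
        rw [Finset.mem_range] at hi
        have h1 : b i (m + 1) = a (m + n) := by
          simp only [hb, insSeq]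
          split_ifs <;> first | omega | exact congrArg a (by omega)
        rw [h1, smul_smul, smul_smul]
        congr 1
        ring
      · have h1 : b (m + 1) (m + 1) = g.seq (shSeq (m + 1) a) := by simp [hb, insSeq]
        have h2 : f.seq (b (m + 1)) = f.seq a := by
          apply seq_congr
          intro p hp
          simp [hb, insSeq, hp]
        rw [h1, h2, smul_smul]
        congr 1
        ring
    have e2' := e2
    rw [e1, e2, e3]
    abel
  have hfin1 : ((-1) ^ (m + n + 1) : k) = s * (-1) ^ m := by rw [hs, ← pow_add]; ring
  have hfin2 : ((-1) ^ (m * n) : k) = s * ((-1) ^ m * s ^ (m + 1)) := by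
    have h1 : s * ((-1) ^ m * s ^ (m + 1)) = s ^ m * (-1) ^ m := by
      rw [pow_succ]
      linear_combination s ^ m * (-1) ^ m * hs2
    have h2 : ((-1) ^ m * (-1) ^ m : k) = 1 := by
      rw [← pow_add, Even.neg_one_pow ⟨m, rfl⟩]
    rw [h1, ← hS, mul_add, mul_one, pow_add]
    linear_combination -(-1 : k) ^ (m * n) * h2
  rw [hLHS, hfdg, hdfg, hfin1, hfin2]
  simp only [smul_add, smul_sub, smul_smul, hs2, one_smul]
  abel

/-- Change of a degree `p` into an equal one. -/
def cast {p q : ℕ} (h : p = q) (f : BarCochain k A A p) : BarCochain k A A q :=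
  MultilinearMap.domDomCongr (finCongr h) f

theorem cast_seq {p q : ℕ} (h : p = q) (f : BarCochain k A A p) (a : ℕ → A) :
    (cast h f).seq a = f.seq a := by
  subst h
  rfl

theorem dH_cast {p q : ℕ} (h : p = q) (f : BarCochain k A A p) :
    dH k A q (cast h f) = cast (congrArg (· + 1) h) (dH k A p f) := by
  subst h
  rfl

theorem sub_seq {n : ℕ} (f g : BarCochain k A A n) (a : ℕ → A) :
    (f - g).seq a = f.seq a - g.seq a := rfl

theorem add_seq {n : ℕ} (f g : BarCochain k A A n) (a : ℕ → A) :
    (f + g).seq a = f.seq a + g.seq a := rfl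

theorem smul_seq {n : ℕ} (c : k) (f : BarCochain k A A n) (a : ℕ → A) :
    (c • f).seq a = c • f.seq a := rfl

theorem zero_seq {n : ℕ} (a : ℕ → A) : (0 : BarCochain k A A n).seq a = 0 := rfl

theorem zero_circ {m n : ℕ} (g : BarCochain k A A n) :
    circ (0 : BarCochain k A A (m + 1)) g = 0 := by
  apply ext_seq
  intro a
  simp [circ_seq, zero_seq]

theorem circ_zero {m n : ℕ} (f : BarCochain k A A (m + 1)) :
    circ f (0 : BarCochain k A A n) = 0 := by
  apply ext_seq
  intro a
  rw [circ_seq, zero_seq]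
  refine Finset.sum_eq_zero fun i hi => ?_
  have := seq_insSeq_smul f (Finset.mem_range.1 hi) n (0 : k) 0 a
  rw [zero_smul, zero_smul] at this
  rw [zero_seq, this, smul_zero]

/-- The Gerstenhaber bracket `[f, g] = f ∘ g - (-1) ^ ((|f| - 1) (|g| - 1)) g ∘ f` of Hochschild
cochains of positive degrees `|f| = m + 1` and `|g| = n + 1`; its degree is `|f| + |g| - 1`. -/
def bracket {m n : ℕ} (f : BarCochain k A A (m + 1)) (g : BarCochain k A A (n + 1)) :
    BarCochain k A A (m + n + 1) :=
  circ f g - (-1 : k) ^ (m * n) • cast (by omega) (circ g f)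

theorem bracket_seq {m n : ℕ} (f : BarCochain k A A (m + 1)) (g : BarCochain k A A (n + 1))
    (a : ℕ → A) :
    (bracket f g).seq a = (circ f g).seq a - (-1 : k) ^ (m * n) • (circ g f).seq a := by
  unfold bracket
  rw [sub_seq, smul_seq, cast_seq]

theorem circ_add {m n : ℕ} (f : BarCochain k A A (m + 1)) (g g' : BarCochain k A A n) :
    circ f (g + g') = circ f g + circ f g' := by
  apply ext_seq
  intro a
  simp only [circ_seq, add_seq]
  rw [← Finset.sum_add_distrib]
  refine Finset.sum_congr rfl fun i hi => ?_
  rw [seq_insSeq_add f (Finset.mem_range.1 hi), smul_add]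

theorem circ_smul {m n : ℕ} (c : k) (f : BarCochain k A A (m + 1)) (g : BarCochain k A A n) :
    circ f (c • g) = c • circ f g := by
  apply ext_seq
  intro a
  simp only [circ_seq, smul_seq]
  rw [Finset.smul_sum]
  refine Finset.sum_congr rfl fun i hi => ?_
  rw [seq_insSeq_smul f (Finset.mem_range.1 hi), smul_comm]

theorem add_circ {m n : ℕ} (f f' : BarCochain k A A (m + 1)) (g : BarCochain k A A n) :
    circ (f + f') g = circ f g + circ f' g := by
  apply ext_seq
  intro a
  simp only [circ_seq, add_seq, smul_add, Finset.sum_add_distrib]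

theorem smul_circ {m n : ℕ} (c : k) (f : BarCochain k A A (m + 1)) (g : BarCochain k A A n) :
    circ (c • f) g = c • circ f g := by
  apply ext_seq
  intro a
  simp only [circ_seq, smul_seq]
  rw [Finset.smul_sum]
  exact Finset.sum_congr rfl fun i _ => smul_comm _ _ _

theorem bracket_mem_cocycles {m n : ℕ} {f : BarCochain k A A (m + 1)}
    {g : BarCochain k A A (n + 1)} (hf : dH k A (m + 1) f = 0) (hg : dH k A (n + 1) g = 0) :
    dH k A (m + n + 1) (bracket f g) = 0 := by
  unfold bracket
  rw [map_sub, map_smul, dH_cast]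
  apply ext_seq
  intro a
  rw [sub_seq, smul_seq, cast_seq]
  have h1 := dH_circ_seq f g a
  have h2 := dH_circ_seq g f a
  rw [hf, hg, zero_circ, circ_zero, zero_seq, zero_seq] at h1 h2
  have e : ((-1) ^ (m * n) * (-1) ^ (m * n) : k) = 1 := by
    rw [← pow_add, Even.neg_one_pow ⟨m * n, rfl⟩]
  change (dH k A (m + (n + 1)) (circ f g)).seq a - _ = 0
  rw [h1, h2]
  simp only [smul_zero, add_zero, zero_sub, smul_sub, smul_neg, smul_smul]
  have e1 : ((-1) ^ (m * n) * (-1) ^ (m + 1 + 1) : k) = (-1) ^ (m * (n + 1)) := by ring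
  have e2 : ((-1) ^ (m * n) * (-1) ^ (n * (m + 1)) : k) = (-1) ^ (n + 1 + 1) := by
    rw [mul_add n, pow_add _ (n * m), mul_comm n m]
    linear_combination (-1 : k) ^ n * e
  rw [e1, e2]
  abel

theorem bracket_dH_mem {m n : ℕ} {f : BarCochain k A A (m + 1)} (hf : dH k A (m + 1) f = 0)
    (b : BarCochain k A A n) :
    bracket f (dH k A n b) ∈ LinearMap.range (dH k A (m + n)) := by
  have e : ((-1) ^ (m * n) * (-1) ^ (m * n) : k) = 1 := by
    rw [← pow_add, Even.neg_one_pow ⟨m * n, rfl⟩]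
  cases n with
  | zero =>
    refine ⟨circ f b, ?_⟩
    apply ext_seq
    intro a
    have h1 := dH_circ_seq f b a
    rw [hf, zero_circ, zero_seq] at h1
    rw [h1, bracket_seq]
    have h2 : (circ (dH k A 0 b) f).seq a = f.seq a * b.seq (shSeq (m + 1) a)
        - b.seq a * f.seq (shSeq 0 a) := by
      have h3 : ∀ c : ℕ → A, b.seq c = b.seq a := fun c => seq_congr b (by omega)
      have h4 : f.seq (shSeq 0 a) = f.seq a := by congr 1; funext p; simp [shSeq]
      rw [circ_seq, Finset.sum_range_one, dH_seq, h3, h3 (insSeq _ _ _ _), h3 (shSeq (m + 1) a), h4]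
      simp [insSeq, sub_eq_add_neg]
    rw [h2]
    simp
    abel
  | succ n =>
    refine ⟨circ f b - (-1 : k) ^ (m * (n + 1) + m) • cast (by omega) (circ b f), ?_⟩
    rw [map_sub, map_smul, dH_cast]
    apply ext_seq
    intro a
    have h1 := dH_circ_seq f b a
    have h2 := dH_circ_seq b f a
    rw [hf, zero_circ, zero_seq] at h1
    rw [hf, circ_zero, zero_seq] at h2
    rw [sub_seq, smul_seq, cast_seq, bracket_seq, h1, h2]
    simp only [smul_zero, zero_add, add_zero, smul_sub, smul_smul]
    have em : ((-1) ^ m * (-1) ^ m : k) = 1 := by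
      rw [← pow_add, Even.neg_one_pow ⟨m, rfl⟩]
    have e1 : ((-1) ^ (m * (n + 1) + m) * (-1) ^ (m + 1 + 1) : k) = (-1) ^ (m * (n + 1)) := by
      rw [pow_add, pow_succ, pow_succ]
      linear_combination (-1 : k) ^ (m * (n + 1)) * em
    have e2 : ((-1) ^ (m * (n + 1) + m) * (-1) ^ (n * (m + 1)) : k) = (-1) ^ n := by
      have : ((-1) ^ (m * n) * (-1) ^ (m * n) : k) = 1 := by
        rw [← pow_add, Even.neg_one_pow ⟨m * n, rfl⟩]
      rw [show n * (m + 1) = m * n + n by ring, show m * (n + 1) + m = m * n + m + m by ring,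
        pow_add, pow_add, pow_add]
      linear_combination (-1 : k) ^ n * (-1) ^ (m * n) * (-1) ^ (m * n) * em + (-1 : k) ^ n * this
    have e3 : ((-1) ^ (n + 1 + 1) : k) = (-1) ^ n := by ring
    rw [e1, e2, e3]
    abel

theorem bracket_skew {m n : ℕ} (f : BarCochain k A A (m + 1)) (g : BarCochain k A A (n + 1)) :
    bracket g f = (-(-1 : k) ^ (m * n)) • cast (by omega) (bracket f g) := by
  apply ext_seq
  intro a
  have e : ((-1) ^ (m * n) * (-1) ^ (m * n) : k) = 1 := by
    rw [← pow_add, Even.neg_one_pow ⟨m * n, rfl⟩]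
  rw [smul_seq, cast_seq, bracket_seq, bracket_seq, smul_sub, smul_smul, neg_mul, e,
    mul_comm n m]
  module

theorem dH_bracket_mem {m n : ℕ} {f : BarCochain k A A (m + 1)} (hf : dH k A (m + 1) f = 0)
    (b : BarCochain k A A n) :
    bracket (dH k A n b) f ∈ LinearMap.range (dH k A (n + m)) := by
  rw [bracket_skew f]
  refine Submodule.smul_mem _ _ ?_
  obtain ⟨c, hc⟩ := bracket_dH_mem hf b
  rw [← hc]
  exact ⟨cast (by omega) c, dH_cast (by omega) c⟩

end Circle
end BarCochain

namespace BarCochain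

section CohomologyMap

variable {k A M N : Type*} [Field k] [Ring A] [Algebra k A] [AddCommGroup M] [Module k M]
  [AddCommGroup N] [Module k N]

/-- The map induced on cohomology by a cochain map. -/
def mapCohomology {L R : A →ₗ[k] M →ₗ[k] M} {L' R' : A →ₗ[k] N →ₗ[k] N}
    (T : ∀ n, BarCochain k A M n →ₗ[k] BarCochain k A N n)
    (hT : ∀ n φ, d L' R' n (T n φ) = T (n + 1) (d L R n φ)) (n : ℕ) :
    Cohomology L R n →ₗ[k] Cohomology L' R' n :=
  Submodule.mapQ _ _
    ((T n).restrict (p := cocycles L R n) (q := cocycles L' R' n) fun φ hφ => by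
      rw [cocycles, LinearMap.mem_ker] at hφ ⊢
      rw [hT, hφ, map_zero])
    (by
      rintro ⟨φ, hφ⟩ h
      rw [Submodule.mem_comap, Submodule.subtype_apply] at h
      rw [Submodule.mem_comap, Submodule.mem_comap, Submodule.subtype_apply]
      cases n with
      | zero =>
        simp only [coboundaries, Submodule.mem_bot] at h ⊢
        simp only [LinearMap.coe_restrict_apply]
        rw [h, map_zero]
      | succ n =>
        obtain ⟨b, hb⟩ := h
        exact ⟨T n b, (hT n b).trans (congrArg (T (n + 1)) hb)⟩)

end CohomologyMap

end BarCochain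

section Hochschild

open BarCochain

variable (k A : Type*) [Field k] [Ring A] [Algebra k A]

/-- The Hochschild cohomology `HHⁿ(A)` of the `k`-algebra `A` with coefficients in `A`, i.e.
`Extⁿ` of `A` by `A` over `A ⊗ Aᵒᵖ`, computed by the bar resolution of `A`. -/
abbrev HochschildCohomology (n : ℕ) : Type _ :=
  Cohomology (LinearMap.mul k A) (LinearMap.mul k A).flip n

/-- The Gerstenhaber bracket of two Hochschild cocycles of positive degrees, as a Hochschild
cohomology class. -/
def cocycleBracket (m n : ℕ) :
    cocycles (LinearMap.mul k A) (LinearMap.mul k A).flip (m + 1) →ₗ[k]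
      cocycles (LinearMap.mul k A) (LinearMap.mul k A).flip (n + 1) →ₗ[k]
        HochschildCohomology k A (m + n + 1) :=
  LinearMap.mk₂ k
    (fun f g => Submodule.Quotient.mk ⟨bracket f.1 g.1, bracket_mem_cocycles f.2 g.2⟩)
    (by
      intro f f' g
      rw [← Submodule.Quotient.mk_add]
      congr 1
      ext1
      apply ext_seq
      intro a
      simp only [Submodule.coe_add, bracket_seq, add_seq, add_circ, circ_add, smul_add]
      abel)
    (by
      intro c f g
      rw [← Submodule.Quotient.mk_smul]
      congr 1
      ext1
      apply ext_seq
      intro a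
      simp only [Submodule.coe_smul, bracket_seq, smul_seq, smul_circ, circ_smul, smul_sub,
        smul_comm c])
    (by
      intro f g g'
      rw [← Submodule.Quotient.mk_add]
      congr 1
      ext1
      apply ext_seq
      intro a
      simp only [Submodule.coe_add, bracket_seq, add_seq, add_circ, circ_add, smul_add]
      abel)
    (by
      intro c f g
      rw [← Submodule.Quotient.mk_smul]
      congr 1
      ext1
      apply ext_seq
      intro a
      simp only [Submodule.coe_smul, bracket_seq, smul_seq, smul_circ, circ_smul, smul_sub,
        smul_comm c])

/-- The Gerstenhaber bracket `HHᵐ⁺¹(A) × HHⁿ⁺¹(A) → HHᵐ⁺ⁿ⁺¹(A)` on Hochschild cohomology in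
positive degrees, induced by the bracket of cocycles. -/
def gerstenhaberBracket (m n : ℕ) :
    HochschildCohomology k A (m + 1) →ₗ[k] HochschildCohomology k A (n + 1) →ₗ[k]
      HochschildCohomology k A (m + n + 1) :=
  Submodule.liftQ _
    (LinearMap.flip (Submodule.liftQ _ (cocycleBracket k A m n).flip (by
      rintro ⟨g, hg⟩ h
      rw [Submodule.mem_comap, Submodule.subtype_apply] at h
      obtain ⟨b, rfl⟩ := h
      rw [LinearMap.mem_ker]
      ext f
      exact (Submodule.Quotient.mk_eq_zero _).2 (bracket_dH_mem f.2 b))))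
    (by
      rintro ⟨f, hf⟩ h
      rw [Submodule.mem_comap, Submodule.subtype_apply] at h
      obtain ⟨b, rfl⟩ := h
      rw [LinearMap.mem_ker]
      apply LinearMap.ext
      intro β
      obtain ⟨g, rfl⟩ := Submodule.Quotient.mk_surjective _ β
      exact (Submodule.Quotient.mk_eq_zero _).2 (dH_bracket_mem g.2 b))

/-- The bracket of classes is computed on any representatives. -/
theorem gerstenhaberBracket_mk {m n : ℕ}
    (f : cocycles (LinearMap.mul k A) (LinearMap.mul k A).flip (m + 1))
    (g : cocycles (LinearMap.mul k A) (LinearMap.mul k A).flip (n + 1)) :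
    gerstenhaberBracket k A m n (Submodule.Quotient.mk f) (Submodule.Quotient.mk g)
      = Submodule.Quotient.mk ⟨bracket f.1 g.1, bracket_mem_cocycles f.2 g.2⟩ := rfl

end Hochschild

namespace BarCochain

section Pairing

variable {k A B M N P : Type*} [Field k] [Ring A] [Algebra k A] [Ring B] [Algebra k B]
  [AddCommGroup M] [Module k M] [AddCommGroup N] [Module k N] [AddCommGroup P] [Module k P]

/-- The multilinear map `f ⊗ g` with
`(f ⊗ g) (a₁ ⊗ b₁, …, aₙ ⊗ bₙ) = f (a₁, …, aₙ) ⊗ g (b₁, …, bₙ)`. -/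
noncomputable def tensor : ∀ n : ℕ, BarCochain k A M n →ₗ[k] BarCochain k B N n →ₗ[k]
    BarCochain k (A ⊗[k] B) (M ⊗[k] N) n
  | 0 => LinearMap.mk₂ k
      (fun f g => MultilinearMap.constOfIsEmpty k _ (f Fin.elim0 ⊗ₜ[k] g Fin.elim0))
      (by intros; ext; simp [TensorProduct.add_tmul]) (by intros; ext; simp [TensorProduct.smul_tmul'])
      (by intros; ext; simp [TensorProduct.tmul_add]) (by intros; ext; simp)
  | n + 1 => LinearMap.mk₂ k
      (fun f g => (multilinearCurryLeftEquiv k (fun _ => A ⊗[k] B) (M ⊗[k] N)).symm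
        (TensorProduct.lift
        ((tensor n).compl₁₂ (multilinearCurryLeftEquiv k (fun _ => A) M f)
          (multilinearCurryLeftEquiv k (fun _ => B) N g))))
      (by
        intro f f' g
        have h : (f + f').curryLeft = f.curryLeft + f'.curryLeft := rfl
        rw [← map_add]
        congr 1
        ext a b
        simp [h])
      (by
        intro c f g
        rw [← map_smul]
        congr 1
        ext a b
        simp)
      (by
        intro f g g'
        have h : (g + g').curryLeft = g.curryLeft + g'.curryLeft := rfl
        rw [← map_add]
        congr 1
        ext a b
        simp [h])
      (by
        intro c f g
        rw [← map_smul]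
        congr 1
        ext a b
        simp)

theorem tensor_succ {n : ℕ} (f : BarCochain k A M (n + 1)) (g : BarCochain k B N (n + 1))
    (a : A) (b : B) (t : Fin n → A ⊗[k] B) :
    tensor (n + 1) f g (Fin.cons (a ⊗ₜ[k] b) t) = tensor n (f.curryLeft a) (g.curryLeft b) t :=
  rfl

theorem tensor_tmul {n : ℕ} (f : BarCochain k A M n) (g : BarCochain k B N n) (a : Fin n → A)
    (b : Fin n → B) : tensor n f g (fun i => a i ⊗ₜ[k] b i) = f a ⊗ₜ[k] g b := by
  induction n with
  | zero =>
    rw [Subsingleton.elim a Fin.elim0, Subsingleton.elim b Fin.elim0]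
    rfl
  | succ n ih =>
    have h : (fun i => a i ⊗ₜ[k] b i) = (Fin.cons (a 0 ⊗ₜ[k] b 0)
        (fun i => Fin.tail a i ⊗ₜ[k] Fin.tail b i) : Fin (n + 1) → A ⊗[k] B) := by
      funext i
      refine Fin.cases rfl (fun _ => rfl) i
    rw [h, tensor_succ, ih]
    simp

theorem ext_tmul {n : ℕ} {φ ψ : BarCochain k (A ⊗[k] B) M n}
    (h : ∀ (a : Fin n → A) (b : Fin n → B),
      φ (fun i => a i ⊗ₜ[k] b i) = ψ (fun i => a i ⊗ₜ[k] b i)) : φ = ψ := by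
  induction n with
  | zero =>
    ext t
    have := h Fin.elim0 Fin.elim0
    rwa [Subsingleton.elim (fun i : Fin 0 => _) t] at this
  | succ n ih =>
    have key : φ.curryLeft = ψ.curryLeft := by
      apply TensorProduct.ext'
      intro a b
      apply ih
      intro a' b'
      have h1 := h (Fin.cons a a') (Fin.cons b b')
      have h2 : (fun i => (Fin.cons a a' : Fin (n + 1) → A) i ⊗ₜ[k]
          (Fin.cons b b' : Fin (n + 1) → B) i)
          = (Fin.cons (a ⊗ₜ[k] b) (fun i => a' i ⊗ₜ[k] b' i) : Fin (n + 1) → A ⊗[k] B) := by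
        funext i
        refine Fin.cases rfl (fun _ => rfl) i
      rw [h2] at h1
      exact h1
    rw [← MultilinearMap.uncurry_curryLeft φ, key, MultilinearMap.uncurry_curryLeft]

end Pairing

section Hopf

variable (k A : Type*) [Field k] [Ring A] [HopfAlgebra k A]

open Coalgebra HopfAlgebra

/-- The action of `A` on a `k`-module through the counit. -/
noncomputable def trivialAction (M : Type*) [AddCommGroup M] [Module k M] : A →ₗ[k] M →ₗ[k] M :=
  LinearMap.lsmul k M ∘ₗ counit

/-- The left adjoint action `a • b = ∑ a₁ b S(a₂)` of `A` on itself. -/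
noncomputable def adjointAction : A →ₗ[k] A →ₗ[k] A :=
  TensorProduct.lift
    (LinearMap.mk₂ k (fun b c => LinearMap.mulLeft k b ∘ₗ LinearMap.mulRight k (antipode k c))
      (by intros; ext; simp [add_mul]) (by intros; ext; simp)
      (by intros; ext; simp [mul_add]) (by intros; ext; simp)) ∘ₗ comul

/-- The cochain map `Hom(A ^ ⊗ n, k) → Hom(A ^ ⊗ n, A)` given by composition with the unit of
`A`. -/
noncomputable def unitMap (n : ℕ) : BarCochain k A k n →ₗ[k] BarCochain k A A n where
  toFun φ := (Algebra.linearMap k A).compMultilinearMap φ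
  map_add' := by intros; ext; simp
  map_smul' := by intros; ext; simp

/-- The cochain isomorphism from bar cochains with values in the adjoint module `A` to Hochschild
cochains, `(Φ φ) (a¹, …, aⁿ) = ∑ φ (a¹₁, …, aⁿ₁) a¹₂ ⋯ aⁿ₂`. -/
noncomputable def adToHochschild (n : ℕ) : BarCochain k A A n →ₗ[k] BarCochain k A A n where
  toFun φ := ((LinearMap.mul' k A).compMultilinearMap
    (tensor n φ (MultilinearMap.mkPiAlgebraFin k n A))).compLinearMap fun _ => comul
  map_add' := by intros; ext; simp
  map_smul' := by intros; ext; simp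

variable {k A}

theorem adjointAction_apply_aux (v w : A) (a : A) :
    LinearMap.mul' k A (TensorProduct.map ((adjointAction k A).flip v) (LinearMap.mulRight k w)
      (comul (R := k) a)) = a * v * w := by
  set T : A ⊗[k] (A ⊗[k] A) →ₗ[k] A :=
    TensorProduct.lift ((LinearMap.mul k A).compl₁₂ (LinearMap.mulRight k v)
      (LinearMap.mulRight k w ∘ₗ LinearMap.mul' k A ∘ₗ (antipode k (A := A)).rTensor A)) with hT
  have h1 : ∀ t : A ⊗[k] A, LinearMap.mul' k A (TensorProduct.map ((adjointAction k A).flip v)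
      (LinearMap.mulRight k w) t)
      = T (TensorProduct.assoc k A A A ((comul (R := k) (A := A)).rTensor A t)) := by
    intro t
    induction t with
    | zero => simp
    | add x y hx hy => simp only [map_add, hx, hy]
    | tmul l r =>
      simp only [TensorProduct.map_tmul, LinearMap.mul'_apply, LinearMap.flip_apply,
        LinearMap.mulRight_apply, LinearMap.rTensor_tmul, adjointAction, LinearMap.comp_apply]
      generalize comul (R := k) l = s
      induction s with
      | zero => simp
      | add x y hx hy =>
        simp only [map_add, LinearMap.add_apply, add_mul, hx, hy, TensorProduct.add_tmul]
      | tmul p q => simp [hT, mul_assoc]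
  have h2 : ∀ t : A ⊗[k] A, T ((comul (R := k) (A := A)).lTensor A t)
      = TensorProduct.lift ((LinearMap.mul k A).compl₁₂ (LinearMap.mulRight k v)
        (LinearMap.mulRight k w ∘ₗ Algebra.linearMap k A))
        ((counit (R := k) (A := A)).lTensor A t) := by
    intro t
    induction t with
    | zero => simp
    | add x y hx hy => simp only [map_add, hx, hy]
    | tmul l r => simp [hT]
  rw [h1, coassoc_apply, h2, lTensor_counit_comul]
  simp [mul_assoc]

theorem unitMap_d (n : ℕ) (φ : BarCochain k A k n) :
    d (adjointAction k A) (trivialAction k A A) n (unitMap k A n φ)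
      = unitMap k A (n + 1) (d (trivialAction k A k) (trivialAction k A k) n φ) := by
  have had : ∀ (a : A) (c : k), adjointAction k A a (algebraMap k A c)
      = algebraMap k A (counit a * c) := by
    intro a c
    have h : ∀ t : A ⊗[k] A, TensorProduct.lift
        (LinearMap.mk₂ k (fun b c => LinearMap.mulLeft k b ∘ₗ LinearMap.mulRight k (antipode k c))
        (by intros; ext; simp [add_mul]) (by intros; ext; simp)
        (by intros; ext; simp [mul_add]) (by intros; ext; simp)) t (algebraMap k A c)
        = LinearMap.mul' k A ((antipode k (A := A)).lTensor A t) * algebraMap k A c := by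
      intro t
      induction t with
      | zero => simp
      | add x y hx hy => simp only [map_add, LinearMap.add_apply, hx, hy, add_mul]
      | tmul l r =>
        simp [mul_assoc, Algebra.commutes]
    rw [adjointAction, LinearMap.comp_apply, h, mul_antipode_lTensor_comul_apply, map_mul]
  ext a
  simp only [d_apply, unitMap, LinearMap.coe_mk, AddHom.coe_mk, LinearMap.compMultilinearMap_apply,
    Algebra.linearMap_apply, had]
  simp only [map_add, map_sum, trivialAction, LinearMap.comp_apply,
    LinearMap.lsmul_apply, Algebra.algebraMap_eq_smul_one, smul_smul, smul_eq_mul]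

theorem adToHochschild_d (n : ℕ) (φ : BarCochain k A A n) :
    d (LinearMap.mul k A) (LinearMap.mul k A).flip n (adToHochschild k A n φ)
      = adToHochschild k A (n + 1) (d (adjointAction k A) (trivialAction k A A) n φ) := by
  have hprod : ∀ {m : ℕ} (r : Fin m → A), MultilinearMap.mkPiAlgebraFin k m A r
      = (List.ofFn r).prod := fun r => by simp
  set Ψ : ∀ m, BarCochain k A A m → BarCochain k (A ⊗[k] A) A m := fun m ψ =>
    (LinearMap.mul' k A).compMultilinearMap
      (tensor m ψ (MultilinearMap.mkPiAlgebraFin k m A)) with hΨ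
  have hΨt : ∀ {m : ℕ} (ψ : BarCochain k A A m) (l r : Fin m → A),
      Ψ m ψ (fun i => l i ⊗ₜ[k] r i) = ψ l * (List.ofFn r).prod := by
    intro m ψ l r
    simp only [hΨ, LinearMap.compMultilinearMap_apply, tensor_tmul, LinearMap.mul'_apply, hprod]
  have hΦ : ∀ {m : ℕ} (ψ : BarCochain k A A m) (a : Fin m → A),
      adToHochschild k A m ψ a = Ψ m ψ (fun i => comul (a i)) := fun ψ a => rfl
  have hface : ∀ j : Fin n, face j (Ψ n φ) = Ψ (n + 1) (face j φ) := by
    intro j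
    apply ext_tmul
    intro l r
    rw [hΨt, face_apply, face_apply]
    have h1 : Fin.contractNth j.castSucc (· * ·) (fun i => l i ⊗ₜ[k] r i)
        = fun i => (Fin.contractNth j.castSucc (· * ·) l i) ⊗ₜ[k]
          (Fin.contractNth j.castSucc (· * ·) r i) := by
      funext i
      simp only [Fin.contractNth]
      split_ifs <;> simp
    rw [h1, hΨt]
    congr 1
    have h2 := congrFun (Fin.partialProd_contractNth r j.castSucc) (Fin.last n)
    simp only [Function.comp_apply] at h2
    rw [Fin.succAbove_of_le_castSucc _ _ (by simp [Fin.le_def])] at h2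
    simp only [Fin.partialProd, Fin.val_last, Fin.succ_last] at h2
    rwa [List.take_of_length_le (by simp), List.take_of_length_le (by simp)] at h2
  have hright : rightTerm ((LinearMap.mul k A).flip ∘ₗ
        TensorProduct.lift (LinearMap.lsmul k A ∘ₗ counit)) (Ψ n φ)
      = Ψ (n + 1) (rightTerm (trivialAction k A A) φ) := by
    apply ext_tmul
    intro l r
    have h1 : Fin.init (fun i : Fin (n + 1) => l i ⊗ₜ[k] r i)
        = fun i => Fin.init l i ⊗ₜ[k] Fin.init r i := rfl
    rw [hΨt, rightTerm_apply, rightTerm_apply, h1, hΨt]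
    have h2 : (List.ofFn r).prod = (List.ofFn (Fin.init r)).prod * r (Fin.last n) := by
      rw [List.ofFn_succ_last]
      simp only [List.prod_append, List.prod_singleton]
      rfl
    rw [h2]
    simp [trivialAction, mul_assoc]
  have hleft : ∀ a : A, (Ψ (n + 1) (leftTerm (adjointAction k A) φ)).curryLeft (comul a)
      = (LinearMap.mulLeft k a).compMultilinearMap (Ψ n φ) := by
    intro a
    apply ext_tmul
    intro l r
    rw [LinearMap.compMultilinearMap_apply, hΨt, LinearMap.mulLeft_apply, ← mul_assoc,
      ← adjointAction_apply_aux (k := k)]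
    generalize (comul a : A ⊗[k] A) = t
    induction t with
    | zero => simp
    | add x y hx hy => simp only [map_add, add_apply, hx, hy]
    | tmul p q =>
      rw [MultilinearMap.curryLeft_apply]
      have h2 : (Fin.cons (p ⊗ₜ[k] q) (fun i => l i ⊗ₜ[k] r i) : Fin (n + 1) → A ⊗[k] A)
          = fun i => (Fin.cons p l : Fin (n + 1) → A) i ⊗ₜ[k]
            (Fin.cons q r : Fin (n + 1) → A) i := by
        funext i
        refine Fin.cases rfl (fun _ => rfl) i
      rw [h2, hΨt]
      simp [List.ofFn_succ]
  ext a
  rw [d_apply, hΦ (d _ _ n φ)]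
  set t : Fin (n + 1) → A ⊗[k] A := fun i => comul (a i) with ht
  have e1 : Ψ (n + 1) (leftTerm (adjointAction k A) φ) t
      = a 0 * adToHochschild k A n φ (Fin.tail a) := by
    have h := congrArg (fun ψ => ψ (Fin.tail t)) (hleft (a 0))
    simp only [MultilinearMap.curryLeft_apply, LinearMap.compMultilinearMap_apply,
      LinearMap.mulLeft_apply] at h
    rw [← Fin.cons_self_tail t]
    exact h
  have e2 : ∀ j : Fin n, Ψ (n + 1) (face j φ) t
      = adToHochschild k A n φ (Fin.contractNth j.castSucc (· * ·) a) := by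
    intro j
    rw [← hface, face_apply, hΦ]
    congr 1
    funext i
    simp only [Fin.contractNth, ht]
    split_ifs <;> simp
  have e3 : Ψ (n + 1) (rightTerm (trivialAction k A A) φ) t
      = adToHochschild k A n φ (Fin.init a) * a (Fin.last n) := by
    rw [← hright, rightTerm_apply, hΦ]
    have h : ∀ s : A ⊗[k] A, TensorProduct.lift (LinearMap.lsmul k A ∘ₗ counit) s
        = TensorProduct.lid k A ((counit (R := k) (A := A)).rTensor A s) := by
      intro s
      induction s with
      | zero => simp
      | add x y hx hy => simp only [map_add, hx, hy]
      | tmul p q => simp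
    simp only [LinearMap.comp_apply, LinearMap.flip_apply, h, ht, rTensor_counit_comul,
      TensorProduct.lid_tmul, one_smul]
    rfl
  have hlin : Ψ (n + 1) (d (adjointAction k A) (trivialAction k A A) n φ) t
      = Ψ (n + 1) (leftTerm (adjointAction k A) φ) t
        + ∑ j : Fin n, (-1 : k) ^ (j + 1 : ℕ) • Ψ (n + 1) (face j φ) t
        + (-1 : k) ^ (n + 1) • Ψ (n + 1) (rightTerm (trivialAction k A A) φ) t := by
    simp [hΨ, d, sum_apply]
  rw [hlin, e1, e3]
  simp only [e2]
  rfl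

end Hopf
end BarCochain

section Embedding

open BarCochain Coalgebra

variable (k A : Type*) [Field k] [Ring A] [HopfAlgebra k A]

/-- The Hopf algebra cohomology `Hⁿ(A, k) = Extⁿ_A(k, k)`, computed by the bar resolution of the
trivial module `k`. -/
abbrev HopfCohomology (n : ℕ) : Type _ :=
  Cohomology (trivialAction k A k) (trivialAction k A k) n

/-- The cohomology `Hⁿ(A, A^ad)` with coefficients in the left adjoint module. -/
abbrev AdjointCohomology (n : ℕ) : Type _ :=
  Cohomology (adjointAction k A) (trivialAction k A A) n

/-- The embedding of Hopf algebra cohomology into Hochschild cohomology: the map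
`Hⁿ(A, k) → Hⁿ(A, A^ad)` induced by the unit of `A`, followed by `Hⁿ(A, A^ad) ≅ HHⁿ(A)`. -/
noncomputable def hopfToHochschild (n : ℕ) : HopfCohomology k A n →ₗ[k] HochschildCohomology k A n :=
  mapCohomology (L := adjointAction k A) (R := trivialAction k A A)
      (adToHochschild k A) adToHochschild_d n ∘ₗ
    mapCohomology (unitMap k A) unitMap_d n

/-- Composition with the counit, which gives a retraction of the embedding. -/
noncomputable def counitMap (n : ℕ) : BarCochain k A A n →ₗ[k] BarCochain k A k n where
  toFun φ := (counit (R := k) (A := A)).compMultilinearMap φ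
  map_add' := by intros; ext; simp
  map_smul' := by intros; ext; simp

theorem counitMap_d (n : ℕ) (φ : BarCochain k A A n) :
    d (trivialAction k A k) (trivialAction k A k) n (counitMap k A n φ)
      = counitMap k A (n + 1) (d (LinearMap.mul k A) (LinearMap.mul k A).flip n φ) := by
  ext a
  simp only [d_apply, counitMap, LinearMap.coe_mk, AddHom.coe_mk,
    LinearMap.compMultilinearMap_apply, map_add, map_sum, map_smul]
  simp [trivialAction, mul_comm]

theorem counitMap_adToHochschild_unitMap (n : ℕ) (φ : BarCochain k A k n) :
    counitMap k A n (adToHochschild k A n (unitMap k A n φ)) = φ := by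
  have key : (counit (R := k) (A := A)).compMultilinearMap ((LinearMap.mul' k A).compMultilinearMap
      (tensor n (unitMap k A n φ) (MultilinearMap.mkPiAlgebraFin k n A)))
      = φ.compLinearMap fun _ => (TensorProduct.rid k A).toLinearMap ∘ₗ
          (counit (R := k) (A := A)).lTensor A := by
    apply ext_tmul
    intro a b
    have h : (fun i => counit (R := k) (b i) • a i)
        = fun i => (fun i => counit (R := k) (b i)) i • a i := rfl
    simp only [LinearMap.compMultilinearMap_apply, tensor_tmul, MultilinearMap.compLinearMap_apply,
      LinearMap.comp_apply, LinearMap.lTensor_tmul, LinearEquiv.coe_coe, TensorProduct.rid_tmul,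
      LinearMap.mul'_apply]
    rw [h, MultilinearMap.map_smul_univ]
    simp only [unitMap, LinearMap.coe_mk, AddHom.coe_mk, LinearMap.compMultilinearMap_apply,
      Algebra.linearMap_apply, MultilinearMap.mkPiAlgebraFin_apply, Bialgebra.counit_mul,
      Bialgebra.counit_algebraMap]
    rw [← Bialgebra.counitAlgHom_apply, map_list_prod, List.map_ofFn, List.prod_ofFn]
    simp [mul_comm]
  ext a
  have := congrArg (fun ψ => ψ (fun i => comul (R := k) (a i))) key
  simp only [MultilinearMap.compLinearMap_apply, LinearMap.comp_apply, lTensor_counit_comul,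
    LinearEquiv.coe_coe, TensorProduct.rid_tmul, one_smul] at this
  exact this

theorem hopfToHochschild_injective (n : ℕ) : Function.Injective (hopfToHochschild k A n) := by
  have h : ∀ α, mapCohomology (counitMap k A) (counitMap_d k A) n
      (hopfToHochschild k A n α) = α := by
    intro α
    obtain ⟨f, rfl⟩ := Submodule.Quotient.mk_surjective _ α
    change Submodule.Quotient.mk _ = Submodule.Quotient.mk _
    congr 1
    ext1
    exact counitMap_adToHochschild_unitMap k A n f.1
  exact Function.LeftInverse.injective h

end Embedding

/-- The two generators of a Taft algebra. -/
inductive TaftGen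
  | x
  | g

/-- The defining relations `g x = ω x g`, `x ^ n = 0`, `g ^ n = 1`. -/
inductive TaftRel {k : Type*} [Field k] (n : ℕ) (ω : k) :
    FreeAlgebra k TaftGen → FreeAlgebra k TaftGen → Prop
  | gx : TaftRel n ω (FreeAlgebra.ι k TaftGen.g * FreeAlgebra.ι k TaftGen.x)
      (ω • (FreeAlgebra.ι k TaftGen.x * FreeAlgebra.ι k TaftGen.g))
  | x_pow : TaftRel n ω (FreeAlgebra.ι k TaftGen.x ^ n) 0
  | g_pow : TaftRel n ω (FreeAlgebra.ι k TaftGen.g ^ n) 1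

/-- The Taft algebra attached to a primitive `n`-th root of unity `ω` of `k`: the `k`-algebra
generated by `x` and `g` with relations `g x = ω x g`, `x ^ n = 0`, `g ^ n = 1`. -/
def TaftAlgebra {k : Type*} [Field k] {n : ℕ} {ω : k} (_ : IsPrimitiveRoot ω n) : Type _ :=
  RingQuot (TaftRel n ω)

namespace TaftAlgebra

section Basic

variable {k : Type*} [Field k] {n : ℕ} {ω : k} (hω : IsPrimitiveRoot ω n)

noncomputable instance : Ring (TaftAlgebra hω) := inferInstanceAs (Ring (RingQuot (TaftRel n ω)))

noncomputable instance : Algebra k (TaftAlgebra hω) :=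
  inferInstanceAs (Algebra k (RingQuot (TaftRel n ω)))

/-- The generator `x`. -/
noncomputable def x : TaftAlgebra hω :=
  RingQuot.mkAlgHom k (TaftRel n ω) (FreeAlgebra.ι k TaftGen.x)

/-- The generator `g`. -/
noncomputable def g : TaftAlgebra hω :=
  RingQuot.mkAlgHom k (TaftRel n ω) (FreeAlgebra.ι k TaftGen.g)

theorem g_mul_x : g hω * x hω = ω • (x hω * g hω) := by
  have h := RingQuot.mkAlgHom_rel k (TaftRel.gx (n := n) (ω := ω))
  rw [map_mul, map_smul, map_mul] at h
  exact h

theorem x_pow : x hω ^ n = 0 := by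
  have h := RingQuot.mkAlgHom_rel k (TaftRel.x_pow (n := n) (ω := ω))
  rw [map_pow, map_zero] at h
  exact h

theorem g_pow : g hω ^ n = 1 := by
  have h := RingQuot.mkAlgHom_rel k (TaftRel.g_pow (n := n) (ω := ω))
  rw [map_pow, map_one] at h
  exact h

/-- The universal property of the presentation. -/
noncomputable def lift {R : Type*} [Ring R] [Algebra k R] (X G : R)
    (h₁ : G * X = ω • (X * G)) (h₂ : X ^ n = 0) (h₃ : G ^ n = 1) : TaftAlgebra hω →ₐ[k] R :=
  RingQuot.liftAlgHom k ⟨FreeAlgebra.lift k fun i => TaftGen.casesOn i X G, by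
    intro a b hab
    cases hab with
    | gx => simpa [FreeAlgebra.lift_ι_apply] using h₁
    | x_pow => simpa [FreeAlgebra.lift_ι_apply] using h₂
    | g_pow => simpa [FreeAlgebra.lift_ι_apply] using h₃⟩

@[simp] theorem lift_x {R : Type*} [Ring R] [Algebra k R] (X G : R)
    (h₁ : G * X = ω • (X * G)) (h₂ : X ^ n = 0) (h₃ : G ^ n = 1) :
    lift hω X G h₁ h₂ h₃ (x hω) = X := by
  unfold lift x
  erw [RingQuot.liftAlgHom_mkAlgHom_apply]
  simp

@[simp] theorem lift_g {R : Type*} [Ring R] [Algebra k R] (X G : R)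
    (h₁ : G * X = ω • (X * G)) (h₂ : X ^ n = 0) (h₃ : G ^ n = 1) :
    lift hω X G h₁ h₂ h₃ (g hω) = G := by
  unfold lift g
  erw [RingQuot.liftAlgHom_mkAlgHom_apply]
  simp

theorem induction {p : TaftAlgebra hω → Prop} (hx : p (x hω)) (hg : p (g hω))
    (hc : ∀ c : k, p (algebraMap k _ c)) (hadd : ∀ a b, p a → p b → p (a + b))
    (hmul : ∀ a b, p a → p b → p (a * b)) (a : TaftAlgebra hω) : p a := by
  obtain ⟨w, rfl⟩ := RingQuot.mkAlgHom_surjective k (TaftRel n ω) a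
  induction w using FreeAlgebra.induction with
  | grade0 c =>
    rw [AlgHom.commutes]
    exact hc c
  | grade1 i =>
    cases i
    · exact hx
    · exact hg
  | mul a b ha hb =>
    rw [map_mul]
    exact hmul _ _ ha hb
  | add a b ha hb =>
    rw [map_add]
    exact hadd _ _ ha hb

theorem algHom_ext {R : Type*} [Ring R] [Algebra k R] {φ ψ : TaftAlgebra hω →ₐ[k] R}
    (hx : φ (x hω) = ψ (x hω)) (hg : φ (g hω) = ψ (g hω)) : φ = ψ := by
  ext a
  induction a using TaftAlgebra.induction hω with
  | hx => exact hx
  | hg => exact hg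
  | hc c => simp
  | hadd a b ha hb => simp [ha, hb]
  | hmul a b ha hb => simp [ha, hb]

end Basic

section QBinomial

variable {k : Type*} [Field k]

/-- The coefficients of `(X + Y) ^ m` when `Y X = ω X Y`. -/
def qCoeff (ω : k) : ℕ → ℕ → k
  | _, 0 => 1
  | 0, _ + 1 => 0
  | m + 1, i + 1 => qCoeff ω m i + ω ^ (i + 1) * qCoeff ω m (i + 1)

theorem qCoeff_zero_right (ω : k) (m : ℕ) : qCoeff ω m 0 = 1 := by cases m <;> rfl

theorem qCoeff_self_add (ω : k) (m j : ℕ) : qCoeff ω m (m + j + 1) = 0 := by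
  induction m generalizing j with
  | zero => simp [qCoeff]
  | succ m ih =>
    have h1 := ih j
    have h2 := ih (j + 1)
    rw [show m + 1 + j + 1 = (m + j + 1) + 1 by ring, qCoeff, h1,
      show m + j + 1 + 1 = m + (j + 1) + 1 by ring, h2]
    simp

theorem qCoeff_self (ω : k) (m : ℕ) : qCoeff ω m m = 1 := by
  induction m with
  | zero => rfl
  | succ m ih =>
    have := qCoeff_self_add ω m 0
    rw [add_zero] at this
    rw [qCoeff, ih, this]
    simp

theorem qCoeff_mul (ω : k) (m i : ℕ) :
    (ω ^ (i + 1) - 1) * qCoeff ω (m + 1) (i + 1) = (ω ^ (m + 1) - 1) * qCoeff ω m i := by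
  induction m generalizing i with
  | zero =>
    cases i with
    | zero => simp [qCoeff]
    | succ i => simp [qCoeff]
  | succ m ih =>
    have h1 := ih i
    rw [qCoeff, mul_add, mul_left_comm, h1]
    cases i with
    | zero =>
      simp only [qCoeff_zero_right]
      ring
    | succ i =>
      have h2 := ih i
      have h3 : ω ^ (i + 1) * qCoeff ω m (i + 1) = qCoeff ω (m + 1) (i + 1) - qCoeff ω m i := by
        rw [qCoeff]; ring
      linear_combination (ω ^ (m + 1) - 1) * ω * h3 + ω * h2

theorem add_pow_of_qComm {R : Type*} [Ring R] [Algebra k R] {ω : k} {X Y : R}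
    (h : Y * X = ω • (X * Y)) (m : ℕ) :
    (X + Y) ^ m = ∑ i ∈ Finset.range (m + 1), qCoeff ω m i • (X ^ i * Y ^ (m - i)) := by
  have hY : ∀ i : ℕ, Y * X ^ i = ω ^ i • (X ^ i * Y) := by
    intro i
    induction i with
    | zero => simp
    | succ i ih =>
      rw [pow_succ, ← mul_assoc, ih, smul_mul_assoc, mul_assoc, h, mul_smul_comm, smul_smul,
        ← pow_succ, mul_assoc]
  induction m with
  | zero => simp [qCoeff]
  | succ m ih =>
    rw [pow_succ', ih, add_mul, Finset.mul_sum, Finset.mul_sum, Finset.sum_range_succ' _ (m + 1)]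
    have hlast : ∑ i ∈ Finset.range (m + 1), Y * qCoeff ω m i • (X ^ i * Y ^ (m - i))
        = ∑ i ∈ Finset.range (m + 2), (ω ^ i * qCoeff ω m i) • (X ^ i * Y ^ (m + 1 - i)) := by
      rw [Finset.sum_range_succ _ (m + 1)]
      have := qCoeff_self_add ω m 0
      rw [add_zero] at this
      rw [this, mul_zero, zero_smul, add_zero]
      refine Finset.sum_congr rfl fun i hi => ?_
      rw [Finset.mem_range] at hi
      rw [mul_smul_comm, ← mul_assoc, hY, smul_mul_assoc, smul_smul, mul_assoc, ← pow_succ',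
        mul_comm (qCoeff ω m i), show m - i + 1 = m + 1 - i by omega]
    rw [hlast, Finset.sum_range_succ' _ (m + 1), ← add_assoc, ← Finset.sum_add_distrib]
    congr 1
    · refine Finset.sum_congr rfl fun i hi => ?_
      rw [qCoeff, add_smul, mul_smul_comm, ← mul_assoc, ← pow_succ',
        show m + 1 - (i + 1) = m - i by omega]
    · simp [qCoeff_zero_right]

theorem add_pow_of_isPrimitiveRoot {R : Type*} [Ring R] [Algebra k R] {n : ℕ} [NeZero n] {ω : k}
    (hω : IsPrimitiveRoot ω n) {X Y : R} (h : Y * X = ω • (X * Y)) :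
    (X + Y) ^ n = X ^ n + Y ^ n := by
  obtain ⟨m, rfl⟩ := Nat.exists_eq_succ_of_ne_zero (NeZero.ne n)
  rw [add_pow_of_qComm h, Finset.sum_range_succ, Finset.sum_range_succ', Finset.sum_eq_zero]
  · simp only [Nat.succ_eq_add_one]
    simp [qCoeff_self, qCoeff_zero_right, add_comm]
  · intro i hi
    rw [Finset.mem_range] at hi
    have h1 := qCoeff_mul ω m i
    have h2 : ω ^ (m + 1) = 1 := hω.pow_eq_one
    rw [h2, sub_self, zero_mul, mul_eq_zero] at h1
    have h3 : ω ^ (i + 1) - 1 ≠ 0 :=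
      sub_ne_zero.2 (hω.pow_ne_one_of_pos_of_lt (by omega) (by simp only [Nat.succ_eq_add_one]; omega))
    rw [Nat.succ_eq_add_one, h1.resolve_left h3, zero_smul]

end QBinomial

section Hopf

variable {k : Type*} [Field k] {n : ℕ} [NeZero n] {ω : k} (hω : IsPrimitiveRoot ω n)

/-- The coproduct: `Δ x = x ⊗ 1 + g ⊗ x`, `Δ g = g ⊗ g`. -/
noncomputable def comulHom : TaftAlgebra hω →ₐ[k] TaftAlgebra hω ⊗[k] TaftAlgebra hω :=
  lift hω (x hω ⊗ₜ[k] 1 + g hω ⊗ₜ[k] x hω) (g hω ⊗ₜ[k] g hω)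
    (by
      simp only [mul_add, add_mul, Algebra.TensorProduct.tmul_mul_tmul, mul_one, one_mul,
        g_mul_x, smul_add, TensorProduct.smul_tmul', TensorProduct.tmul_smul])
    (by
      rw [add_pow_of_isPrimitiveRoot hω]
      · simp [Algebra.TensorProduct.tmul_pow, x_pow]
      · simp only [Algebra.TensorProduct.tmul_mul_tmul, mul_one, one_mul,
          g_mul_x, TensorProduct.smul_tmul'])
    (by simp [Algebra.TensorProduct.tmul_pow, g_pow, Algebra.TensorProduct.one_def])

/-- The counit: `ε x = 0`, `ε g = 1`. -/
noncomputable def counitHom : TaftAlgebra hω →ₐ[k] k :=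
  lift hω 0 1 (by simp) (by simp [NeZero.ne n]) (by simp)

noncomputable instance : Bialgebra k (TaftAlgebra hω) :=
  Bialgebra.ofAlgHom (comulHom hω) (counitHom hω)
    (by
      apply algHom_ext
      · simp [comulHom, TensorProduct.add_tmul, TensorProduct.tmul_add, add_assoc,
          Algebra.TensorProduct.one_def]
      · simp [comulHom])
    (by
      apply algHom_ext
      · simp [comulHom, counitHom]
      · simp [comulHom, counitHom])
    (by
      apply algHom_ext
      · simp [comulHom, counitHom]
      · simp [comulHom, counitHom])

theorem comul_eq (a : TaftAlgebra hω) : Coalgebra.comul (R := k) a = comulHom hω a := rfl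

theorem counit_eq (a : TaftAlgebra hω) : Coalgebra.counit (R := k) a = counitHom hω a := rfl

theorem g_mul_g_pow : g hω * g hω ^ (n - 1) = 1 := by
  rw [← pow_succ', Nat.sub_add_cancel (NeZero.pos n), g_pow]

theorem g_pow_mul_g : g hω ^ (n - 1) * g hω = 1 := by
  rw [← pow_succ, Nat.sub_add_cancel (NeZero.pos n), g_pow]

theorem x_mul_g_pow : x hω * g hω ^ (n - 1) = ω • (g hω ^ (n - 1) * x hω) := by
  have h : g hω ^ (n - 1) * (g hω * x hω) * g hω ^ (n - 1)
      = g hω ^ (n - 1) * (ω • (x hω * g hω)) * g hω ^ (n - 1) := by rw [g_mul_x]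
  rw [← mul_assoc, g_pow_mul_g, one_mul, mul_smul_comm, smul_mul_assoc, mul_assoc, mul_assoc,
    g_mul_g_pow, mul_one] at h
  exact h

theorem antipode_x_pow : (-(g hω ^ (n - 1) * x hω)) ^ n = 0 := by
  have h : ∀ m : ℕ, ∃ c : k,
      (g hω ^ (n - 1) * x hω) ^ m = c • ((g hω ^ (n - 1)) ^ m * x hω ^ m) := by
    have hc : ∀ m : ℕ, x hω ^ m * g hω ^ (n - 1) = ω ^ m • (g hω ^ (n - 1) * x hω ^ m) := by
      intro m
      induction m with
      | zero => simp
      | succ m ih =>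
        rw [pow_succ, mul_assoc, x_mul_g_pow, mul_smul_comm, ← mul_assoc, ih, smul_mul_assoc,
          smul_smul, ← pow_succ', mul_assoc]
    intro m
    induction m with
    | zero => exact ⟨1, by simp⟩
    | succ m ih =>
      obtain ⟨c, hcm⟩ := ih
      refine ⟨c * ω ^ m, ?_⟩
      rw [pow_succ, hcm, smul_mul_assoc, mul_assoc, ← mul_assoc (x hω ^ m), hc m, smul_mul_assoc,
        mul_smul_comm, smul_smul]
      congr 1
      rw [pow_succ, pow_succ]
      simp only [mul_assoc]
  obtain ⟨c, hc⟩ := h n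
  rw [neg_pow, hc, x_pow]
  simp

/-- The antipode as an algebra map into the opposite algebra: `S x = - g⁻¹ x`, `S g = g⁻¹`
(where `g⁻¹ = g ^ (n - 1)`). -/
noncomputable def antipodeHom : TaftAlgebra hω →ₐ[k] (TaftAlgebra hω)ᵐᵒᵖ :=
  lift hω (MulOpposite.op (-(g hω ^ (n - 1) * x hω))) (MulOpposite.op (g hω ^ (n - 1)))
    (by
      rw [← MulOpposite.op_mul, ← MulOpposite.op_mul, ← MulOpposite.op_smul]
      congr 1
      rw [neg_mul, mul_neg, mul_assoc, x_mul_g_pow, mul_smul_comm, smul_neg])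
    (by rw [← MulOpposite.op_pow, antipode_x_pow, MulOpposite.op_zero])
    (by rw [← MulOpposite.op_pow, ← pow_mul, mul_comm, pow_mul, g_pow, one_pow, MulOpposite.op_one])

/-- The antipode. -/
noncomputable def antipodeMap : TaftAlgebra hω →ₗ[k] TaftAlgebra hω :=
  (MulOpposite.opLinearEquiv k).symm.toLinearMap ∘ₗ (antipodeHom hω).toLinearMap

theorem antipodeMap_mul (a b : TaftAlgebra hω) :
    antipodeMap hω (a * b) = antipodeMap hω b * antipodeMap hω a := by
  simp [antipodeMap]

theorem antipodeMap_x : antipodeMap hω (x hω) = -(g hω ^ (n - 1) * x hω) := by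
  simp [antipodeMap, antipodeHom]

theorem antipodeMap_g : antipodeMap hω (g hω) = g hω ^ (n - 1) := by
  simp [antipodeMap, antipodeHom]

theorem antipodeMap_algebraMap (c : k) :
    antipodeMap hω (algebraMap k _ c) = algebraMap k _ c := by
  simp [antipodeMap]

theorem antipode_left (a : TaftAlgebra hω) :
    LinearMap.mul' k _ ((antipodeMap hω).rTensor _ (comulHom hω a))
      = algebraMap k _ (counitHom hω a) := by
  have key : ∀ (t : TaftAlgebra hω ⊗[k] TaftAlgebra hω) (l r : TaftAlgebra hω),
      LinearMap.mul' k _ ((antipodeMap hω).rTensor _ (t * l ⊗ₜ[k] r))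
        = antipodeMap hω l * LinearMap.mul' k _ ((antipodeMap hω).rTensor _ t) * r := by
    intro t l r
    induction t with
    | zero => simp
    | tmul p q => simp [antipodeMap_mul, mul_assoc]
    | add p q hp hq => simp only [add_mul, map_add, hp, hq, mul_add]
  induction a using TaftAlgebra.induction hω with
  | hx => simp [comulHom, counitHom, antipodeMap_x, antipodeMap_g]
  | hg => simp [comulHom, counitHom, antipodeMap_g, g_pow_mul_g]
  | hc c => simp [antipodeMap_algebraMap, Algebra.TensorProduct.algebraMap_apply]
  | hadd a b ha hb => simp only [map_add, ha, hb]
  | hmul a b ha hb =>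
    have key2 : ∀ u : TaftAlgebra hω ⊗[k] TaftAlgebra hω,
        LinearMap.mul' k _ ((antipodeMap hω).rTensor _ (comulHom hω a * u))
          = algebraMap k _ (counitHom hω a) *
            LinearMap.mul' k _ ((antipodeMap hω).rTensor _ u) := by
      intro u
      induction u with
      | zero => simp
      | tmul p q =>
        rw [key, ha]
        simp only [LinearMap.rTensor_tmul, LinearMap.mul'_apply]
        rw [← Algebra.commutes, mul_assoc]
      | add p q hp hq => simp only [mul_add, map_add, hp, hq]
    rw [map_mul, key2, hb, map_mul, map_mul]

theorem antipode_right (a : TaftAlgebra hω) :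
    LinearMap.mul' k _ ((antipodeMap hω).lTensor _ (comulHom hω a))
      = algebraMap k _ (counitHom hω a) := by
  have key : ∀ (t : TaftAlgebra hω ⊗[k] TaftAlgebra hω) (l r : TaftAlgebra hω),
      LinearMap.mul' k _ ((antipodeMap hω).lTensor _ (l ⊗ₜ[k] r * t))
        = l * LinearMap.mul' k _ ((antipodeMap hω).lTensor _ t) * antipodeMap hω r := by
    intro t l r
    induction t with
    | zero => simp
    | tmul p q => simp [antipodeMap_mul, mul_assoc]
    | add p q hp hq => simp only [add_mul, map_add, hp, hq, mul_add]
  induction a using TaftAlgebra.induction hω with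
  | hx =>
    simp only [comulHom, counitHom, lift_x, map_add, LinearMap.lTensor_tmul, LinearMap.mul'_apply,
      antipodeMap_x, mul_neg, ← mul_assoc, g_mul_g_pow, one_mul, map_zero]
    have h1 := antipodeMap_algebraMap hω (1 : k)
    rw [map_one] at h1
    rw [h1]
    simp
  | hg => simp [comulHom, counitHom, antipodeMap_g, g_mul_g_pow]
  | hc c =>
    have h1 := antipodeMap_algebraMap hω (1 : k)
    rw [map_one] at h1
    simp [Algebra.TensorProduct.algebraMap_apply, h1]
  | hadd a b ha hb => simp only [map_add, ha, hb]
  | hmul a b ha hb =>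
    have key2 : ∀ u : TaftAlgebra hω ⊗[k] TaftAlgebra hω,
        LinearMap.mul' k _ ((antipodeMap hω).lTensor _ (u * comulHom hω b))
          = LinearMap.mul' k _ ((antipodeMap hω).lTensor _ u) *
            algebraMap k _ (counitHom hω b) := by
      intro u
      induction u with
      | zero => simp
      | tmul p q =>
        rw [key, hb]
        simp only [LinearMap.lTensor_tmul, LinearMap.mul'_apply]
        rw [mul_assoc, mul_assoc, Algebra.commutes]
      | add p q hp hq => simp only [add_mul, map_add, hp, hq]
    rw [map_mul, key2, ha, map_mul, map_mul]

/-- The Hopf algebra structure of the Taft algebra. -/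
noncomputable instance : HopfAlgebra k (TaftAlgebra hω) where
  antipode := antipodeMap hω
  mul_antipode_rTensor_comul := LinearMap.ext fun a => antipode_left hω a
  mul_antipode_lTensor_comul := LinearMap.ext fun a => antipode_right hω a

end Hopf

end TaftAlgebra

/-! The proof is a degree count. The endomorphisms σ_t : x ↦ t x, g ↦ g (`scale`) respect the
coproduct and the counit. Say that a cochain f has internal degree D if f (σ_t a₁, …, σ_t aₘ) = t ^
D • σ_t (f (a₁, …, aₘ)), with σ_t acting as the identity on the coefficients k. The embedding of
H^*(A, k) preserves D (`Equivariant.unitMap`, `Equivariant.adToHochschild`), and the bracket adds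
degrees (`Equivariant.bracket`).

The minimal resolution has generators in degrees 0, 1, n, n + 1, 2n, … (`weight`). With trivial
coefficients every class of arity r ≥ 1 therefore has a representative of degree exactly `weight n
r`. With coefficients in A, whose elements have only nonnegative degrees, a cocycle of degree D >
`weight n r` is a coboundary. Since `weight n (p + 1) + weight n (q + 1)` exceeds `weight n (p + q +
1)` for n ≥ 2 (`weight_add_lt`), the bracket is a coboundary.

No resolution is built. Instead bar cocycles are brought into a normal form that imitates it, for
any bimodule M (`exists_isNormal_sub_d`). Averaging over the powers of g, possible in characteristic
0, makes f linear over k[g] in the first variable, and f (x, ·) twisted-linear in the next one. The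
cocycle identity then determines f by f (x, ·), and a last correction yields f (x, b, …) =
`topCoeff` b · φ with φ a cocycle of arity two less, to which the procedure applies again.
Corrections of φ are lifted to f by the cup product with the 2-cocycle `carry`, (a, b) ↦ (a b) / x ^
n. All corrections inherit the homogeneity of f, so degrees can be read off the normal form:
`IsNormal.equivariant` does this for the coefficients k, and `IsNormal.eq_zero` gives the vanishing
for the coefficients A. Taking t = 2 suffices to separate degrees. For n = 1 the positive cohomology
is zero. -/

namespace BarCochain

/-! ### Bar cochains curried in the first variable. -/

section Curry

variable {k A M : Type*} [Field k] [Ring A] [Algebra k A] [AddCommGroup M] [Module k M]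

/-- Currying of the first variable. -/
def cur {m : ℕ} : BarCochain k A M (m + 1) ≃ₗ[k] (A →ₗ[k] BarCochain k A M m) :=
  multilinearCurryLeftEquiv k (fun _ => A) M

theorem cur_apply {m : ℕ} (φ : BarCochain k A M (m + 1)) (a : A) (t : Fin m → A) :
    cur φ a t = φ (Fin.cons a t) := rfl

theorem cur_ext {m : ℕ} {φ ψ : BarCochain k A M (m + 1)} (h : ∀ a, cur φ a = cur ψ a) :
    φ = ψ :=
  cur.injective (LinearMap.ext h)

/-- The action of `A` on cochains through the values. -/
def lact (L : A →ₗ[k] M →ₗ[k] M) {m : ℕ} :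
    A →ₗ[k] BarCochain k A M m →ₗ[k] BarCochain k A M m :=
  LinearMap.mk₂ k (fun a φ => (L a).compMultilinearMap φ)
    (by intros; ext; simp) (by intros; ext; simp) (by intros; ext; simp) (by intros; ext; simp)

theorem lact_apply (L : A →ₗ[k] M →ₗ[k] M) {m : ℕ} (a : A) (φ : BarCochain k A M m)
    (t : Fin m → A) : lact L a φ t = L a (φ t) := rfl

theorem cur_lact (L : A →ₗ[k] M →ₗ[k] M) {m : ℕ} (a b : A) (φ : BarCochain k A M (m + 1)) :
    cur (lact L a φ) b = lact L a (cur φ b) := rfl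

/-- The part of the differential that does not involve the left action. -/
def dRight (R : A →ₗ[k] M →ₗ[k] M) (m : ℕ) :
    BarCochain k A M m →ₗ[k] BarCochain k A M (m + 1) :=
  d 0 R m

theorem dRight_apply (R : A →ₗ[k] M →ₗ[k] M) {m : ℕ} (φ : BarCochain k A M m)
    (a : Fin (m + 1) → A) :
    dRight R m φ a = ∑ j : Fin m, (-1 : k) ^ (j + 1 : ℕ) • φ (Fin.contractNth j.castSucc (· * ·) a)
      + (-1 : k) ^ (m + 1) • R (a (Fin.last m)) (φ (Fin.init a)) := by
  rw [dRight, d_apply]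
  simp

theorem cur_d (L R : A →ₗ[k] M →ₗ[k] M) {m : ℕ} (φ : BarCochain k A M m) (a : A) :
    cur (d L R m φ) a = lact L a φ + cur (dRight R m φ) a := by
  ext t
  simp [cur_apply, d_apply, dRight_apply, lact_apply, add_assoc]

theorem contractNth_zero_cons_cons {m : ℕ} (a b : A) (t : Fin m → A) :
    Fin.contractNth 0 (· * ·) (Fin.cons a (Fin.cons b t : Fin (m + 1) → A) : Fin (m + 2) → A)
      = Fin.cons (a * b) t := by
  funext i
  refine Fin.cases ?_ (fun i => ?_) i
  · simp [Fin.contractNth]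
  · simp [Fin.contractNth]

theorem contractNth_succ_cons {m : ℕ} (j : Fin (m + 1)) (a : A) (t : Fin (m + 1) → A) :
    Fin.contractNth j.succ (· * ·) (Fin.cons a t : Fin (m + 2) → A)
      = Fin.cons a (Fin.contractNth j (· * ·) t) := by
  funext i
  refine Fin.cases ?_ (fun i => ?_) i
  · simp [Fin.contractNth]
  · simp only [Fin.contractNth, Fin.cons_succ, Fin.val_succ, Nat.add_lt_add_iff_right,
      Nat.add_right_cancel_iff, Fin.castSucc_succ]

/-- The first contraction merges a and b. All other terms leave a alone and form the same
differential in the remaining variables, with the sign shifted by one. This recursion replaces sums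
over faces in everything that follows. -/
theorem cur_cur_dRight (R : A →ₗ[k] M →ₗ[k] M) {m : ℕ} (φ : BarCochain k A M (m + 1)) (a b : A) :
    cur (cur (dRight R (m + 1) φ) a) b = -cur φ (a * b) - cur (dRight R m (cur φ a)) b := by
  ext t
  have hlast : (Fin.cons a (Fin.cons b t : Fin (m + 1) → A) : Fin (m + 2) → A) (Fin.last (m + 1))
      = (Fin.cons b t : Fin (m + 1) → A) (Fin.last m) := by
    rw [← Fin.succ_last, Fin.cons_succ]
  have hinit : Fin.init (Fin.cons a (Fin.cons b t : Fin (m + 1) → A) : Fin (m + 2) → A)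
      = (Fin.cons a (Fin.init (Fin.cons b t : Fin (m + 1) → A)) : Fin (m + 1) → A) := by
    funext i
    refine Fin.cases rfl (fun i => rfl) i
  simp only [cur_apply, dRight_apply, sub_apply, neg_apply]
  rw [Fin.sum_univ_succ, hlast, hinit]
  simp only [Fin.castSucc_zero, contractNth_zero_cons_cons, ← Fin.succ_castSucc,
    contractNth_succ_cons]
  simp only [Fin.val_zero, Fin.val_succ, pow_succ, pow_zero,
    mul_neg, mul_one, neg_smul, one_smul, neg_neg, Finset.sum_neg_distrib]
  abel

/-- The axioms of an `A`-bimodule for a left action `L` and a right action `R`. -/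
structure IsBimodule (L R : A →ₗ[k] M →ₗ[k] M) : Prop where
  one : ∀ m, L 1 m = m
  mul : ∀ a b m, L (a * b) m = L a (L b m)
  comm : ∀ a b m, L a (R b m) = R b (L a m)
  rmul : ∀ a b m, R (a * b) m = R b (R a m)

variable {L R : A →ₗ[k] M →ₗ[k] M}

theorem IsBimodule.lact_one (H : IsBimodule L R) {m : ℕ} (φ : BarCochain k A M m) :
    lact L 1 φ = φ := by
  ext t; exact H.one _

theorem IsBimodule.lact_mul (H : IsBimodule L R) {m : ℕ} (a b : A) (φ : BarCochain k A M m) :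
    lact L (a * b) φ = lact L a (lact L b φ) := by
  ext t; exact H.mul _ _ _

theorem IsBimodule.dRight_lact (H : IsBimodule L R) {m : ℕ} (a : A) (φ : BarCochain k A M m) :
    dRight R m (lact L a φ) = lact L a (dRight R m φ) := by
  ext t
  simp [dRight_apply, lact_apply, H.comm]

theorem cur_cur_d (L R : A →ₗ[k] M →ₗ[k] M) {m : ℕ} (φ : BarCochain k A M (m + 1)) (a b : A) :
    cur (cur (d L R (m + 1) φ) a) b
      = lact L a (cur φ b) - cur φ (a * b) - cur (dRight R m (cur φ a)) b := by
  rw [cur_d, map_add, LinearMap.add_apply, cur_lact, cur_cur_dRight]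
  abel

theorem cur_dRight_zero (R : A →ₗ[k] M →ₗ[k] M) (φ : BarCochain k A M 0) (a : A)
    (t : Fin 0 → A) : cur (dRight R 0 φ) a t = -R a (φ t) := by
  rw [cur_apply, dRight_apply, Subsingleton.elim (Fin.init (Fin.cons a t : Fin 1 → A)) t]
  simp

/-- Peeling off one variable writes the inner cochain as a product term plus a differential of lower
arity; the latter dies by recursion, and the product terms cancel by associativity. In arity 0 the
axiom used is `H.rmul`. -/
theorem IsBimodule.dRight_dRight (H : IsBimodule L R) :
    ∀ {m : ℕ} (φ : BarCochain k A M m), dRight R (m + 1) (dRight R m φ) = 0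
  | 0, φ => by
    refine cur_ext fun a => cur_ext fun b => ?_
    rw [cur_cur_dRight]
    ext t
    simp only [sub_apply, neg_apply, cur_dRight_zero, H.rmul, map_neg, neg_neg, map_zero,
      LinearMap.zero_apply, zero_apply, sub_self]
  | m + 1, φ => by
    refine cur_ext fun a => cur_ext fun b => ?_
    rw [cur_cur_dRight]
    have h1 : cur (dRight R (m + 1) φ) a
        = -cur.symm ((cur φ) ∘ₗ LinearMap.mulLeft k a) - dRight R m (cur φ a) := by
      refine cur_ext fun b => ?_
      rw [cur_cur_dRight]
      simp
    rw [h1, map_sub, H.dRight_dRight, map_neg, sub_zero, map_neg]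
    refine cur_ext fun c => ?_
    simp only [LinearMap.neg_apply, map_sub, map_neg, cur_cur_dRight, LinearEquiv.apply_symm_apply,
      LinearMap.comp_apply, LinearMap.mulLeft_apply, mul_assoc, LinearMap.sub_apply, map_zero,
      LinearMap.zero_apply]
    abel

/-- After `dRight_dRight` only terms with a left action remain; they cancel because the action is
multiplicative and commutes with `dRight`. -/
theorem IsBimodule.d_d (H : IsBimodule L R) {m : ℕ} (φ : BarCochain k A M m) :
    d L R (m + 1) (d L R m φ) = 0 := by
  refine cur_ext fun a => cur_ext fun b => ?_
  have h := congrArg (fun ψ => cur (cur ψ a) b) (H.dRight_dRight φ)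
  simp only [cur_cur_dRight] at h
  rw [cur_cur_d, cur_d, cur_d, cur_d, map_add (dRight R m), LinearEquiv.map_add,
    LinearMap.add_apply, map_add (lact L a), H.dRight_lact, H.lact_mul, cur_lact]
  rw [map_zero, LinearMap.zero_apply, map_zero, LinearMap.zero_apply] at h
  rw [map_zero, LinearMap.zero_apply, map_zero, LinearMap.zero_apply, ← h]
  abel

/-! ### Compatibility of cochains with endomorphisms. -/

section Equivariance

/-- Substitution of `σ` in all variables. -/
def pull (σ : A →ₗ[k] A) {m : ℕ} : BarCochain k A M m →ₗ[k] BarCochain k A M m where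
  toFun φ := φ.compLinearMap fun _ => σ
  map_add' := by intros; ext; simp
  map_smul' := by intros; ext; simp

/-- Composition with a linear map on the values. -/
def push (τ : M →ₗ[k] M) {m : ℕ} : BarCochain k A M m →ₗ[k] BarCochain k A M m where
  toFun φ := τ.compMultilinearMap φ
  map_add' := by intros; ext; simp
  map_smul' := by intros; ext; simp

theorem pull_apply (σ : A →ₗ[k] A) {m : ℕ} (φ : BarCochain k A M m) (t : Fin m → A) :
    pull σ φ t = φ fun i => σ (t i) := rfl

theorem push_apply (τ : M →ₗ[k] M) {m : ℕ} (φ : BarCochain k A M m) (t : Fin m → A) :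
    push τ φ t = τ (φ t) := rfl

theorem cur_pull (σ : A →ₗ[k] A) {m : ℕ} (φ : BarCochain k A M (m + 1)) (a : A) :
    cur (pull σ φ) a = pull σ (cur φ (σ a)) := by
  ext t
  simp only [cur_apply, pull_apply]
  congr 1
  funext i
  refine Fin.cases rfl (fun i => rfl) i

theorem cur_push (τ : M →ₗ[k] M) {m : ℕ} (φ : BarCochain k A M (m + 1)) (a : A) :
    cur (push τ φ) a = push τ (cur φ a) := rfl

theorem pull_lact (σ : A →ₗ[k] A) {m : ℕ} (φ : BarCochain k A M m) (a : A) :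
    pull σ (lact L a φ) = lact L a (pull σ φ) := rfl

theorem pull_zero_arity (σ : A →ₗ[k] A) (φ : BarCochain k A M 0) : pull σ φ = φ := by
  ext t
  rw [pull_apply]
  congr 1
  exact Subsingleton.elim _ _

/-- Compatibility of a linear endomorphism `τ` of `M` with an endomorphism `σ` of `A`. -/
structure IsSemilinear (L R : A →ₗ[k] M →ₗ[k] M) (σ : A →ₐ[k] A) (τ : M →ₗ[k] M) : Prop where
  left : ∀ a m, τ (L a m) = L (σ a) (τ m)
  right : ∀ a m, τ (R a m) = R (σ a) (τ m)

variable {σ : A →ₐ[k] A} {τ : M →ₗ[k] M}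

theorem IsSemilinear.push_lact (H : IsSemilinear L R σ τ) {m : ℕ} (φ : BarCochain k A M m)
    (a : A) : push τ (lact L a φ) = lact L (σ a) (push τ φ) := by
  ext t; exact H.left _ _

theorem contractNth_map {m : ℕ} (σ : A →ₐ[k] A) (j : Fin (m + 1)) (t : Fin (m + 1) → A) :
    Fin.contractNth j (· * ·) (fun i => σ (t i))
      = fun i => σ (Fin.contractNth j (· * ·) t i) := by
  funext i
  simp only [Fin.contractNth]
  split_ifs <;> simp

/-- An algebra map commutes with the inner faces, and `H` handles the two outer ones, so the
differential preserves the factor c. -/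
theorem IsSemilinear.pull_d (H : IsSemilinear L R σ τ) {m : ℕ} {φ : BarCochain k A M m} {c : k}
    (h : pull σ.toLinearMap φ = c • push τ φ) :
    pull σ.toLinearMap (d L R m φ) = c • push τ (d L R m φ) := by
  have h' : ∀ t : Fin m → A, φ (fun i => σ (t i)) = c • τ (φ t) := fun t =>
    congrArg (fun ψ => ψ t) h
  ext t
  have e1 : φ (Fin.tail fun i => σ (t i)) = c • τ (φ (Fin.tail t)) := h' (Fin.tail t)
  have e2 : φ (Fin.init fun i => σ (t i)) = c • τ (φ (Fin.init t)) := h' (Fin.init t)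
  simp only [pull_apply, smul_apply, push_apply, d_apply, AlgHom.toLinearMap_apply,
    contractNth_map, h', e1, e2, map_add, map_sum, map_smul, H.left, H.right, smul_add,
    Finset.smul_sum]
  simp only [smul_comm c]

end Equivariance

end Curry

end BarCochain

namespace TaftAlgebra

/-! ### Linear maps out of the Taft algebra, the top coefficient and the carry cocycle. -/

section Linear

variable {k : Type*} [Field k] {n : ℕ} {ω : k} (hω : IsPrimitiveRoot ω n)

theorem x_pow_of_le {c : ℕ} (h : n ≤ c) : x hω ^ c = 0 := by
  rw [← Nat.add_sub_cancel' h, pow_add, x_pow, zero_mul]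

theorem inv_pow_root (h : IsPrimitiveRoot ω n) : (ω⁻¹) ^ n = 1 := by
  rw [inv_pow, h.pow_eq_one, inv_one]

theorem pow_mulLeft_g (r : k) (hr : r ^ n = 1) :
    (LinearMap.mulLeft k (r • g hω) : Module.End k (TaftAlgebra hω)) ^ n = 1 := by
  rw [LinearMap.pow_mulLeft, smul_pow, hr, g_pow, one_smul, LinearMap.mulLeft_one]
  rfl

/-- The automorphism `x ↦ t x`, `g ↦ g`. -/
noncomputable def scale (t : k) : TaftAlgebra hω →ₐ[k] TaftAlgebra hω :=
  lift hω (t • x hω) (g hω) (by rw [mul_smul_comm, g_mul_x, smul_mul_assoc, smul_comm])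
    (by rw [smul_pow, x_pow, smul_zero]) (g_pow hω)

@[simp] theorem scale_x (t : k) : scale hω t (x hω) = t • x hω := by simp [scale]

@[simp] theorem scale_g (t : k) : scale hω t (g hω) = g hω := by simp [scale]

theorem scale_x_pow (t : k) (c : ℕ) : scale hω t (x hω ^ c) = t ^ c • x hω ^ c := by
  rw [map_pow, scale_x, smul_pow]

variable [NeZero n]

theorem root_ne_zero (h : IsPrimitiveRoot ω n) : ω ≠ 0 := h.ne_zero (NeZero.ne n)

theorem x_mul_g : x hω * g hω = ω⁻¹ • (g hω * x hω) := by
  rw [g_mul_x, smul_smul, inv_mul_cancel₀ (root_ne_zero hω), one_smul]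

theorem x_pow_mul_g (c : ℕ) : x hω ^ c * g hω = (ω⁻¹) ^ c • (g hω * x hω ^ c) := by
  induction c with
  | zero => simp
  | succ c ih =>
    rw [pow_succ', mul_assoc, ih, mul_smul_comm, ← mul_assoc, x_mul_g, smul_mul_assoc, smul_smul,
      mul_assoc, pow_succ]

theorem x_mul_g_pow' (i : ℕ) : x hω * g hω ^ i = (ω⁻¹) ^ i • (g hω ^ i * x hω) := by
  induction i with
  | zero => simp
  | succ i ih =>
    rw [pow_succ, ← mul_assoc, ih, smul_mul_assoc, mul_assoc, x_mul_g, mul_smul_comm, smul_smul,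
      ← mul_assoc, pow_succ]

/-- The span contains 1 and is stable under left multiplication by both generators. -/
theorem span_g_pow_mul_x_pow :
    Submodule.span k (Set.range fun p : ℕ × ℕ => g hω ^ p.1 * x hω ^ p.2) = ⊤ := by
  set S := Submodule.span k (Set.range fun p : ℕ × ℕ => g hω ^ p.1 * x hω ^ p.2)
  have hS : ∀ i c, g hω ^ i * x hω ^ c ∈ S := fun i c => Submodule.subset_span ⟨(i, c), rfl⟩
  have key : ∀ a, ∀ s ∈ S, a * s ∈ S := by
    have gen : ∀ a, (∀ i c, a * (g hω ^ i * x hω ^ c) ∈ S) → ∀ s ∈ S, a * s ∈ S := by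
      intro a h s hs
      induction hs using Submodule.span_induction with
      | mem y hy => obtain ⟨p, rfl⟩ := hy; exact h _ _
      | zero => simp
      | add y z _ _ hy hz => rw [mul_add]; exact S.add_mem hy hz
      | smul r y _ hy => rw [mul_smul_comm]; exact S.smul_mem r hy
    intro a
    induction a using TaftAlgebra.induction hω with
    | hx =>
      refine gen _ fun i c => ?_
      rw [← mul_assoc, x_mul_g_pow', smul_mul_assoc, mul_assoc, ← pow_succ']
      exact S.smul_mem _ (hS _ _)
    | hg =>
      refine gen _ fun i c => ?_
      rw [← mul_assoc, ← pow_succ']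
      exact hS _ _
    | hc r => intro s hs; rw [← Algebra.smul_def]; exact S.smul_mem r hs
    | hadd a b ha hb => intro s hs; rw [add_mul]; exact S.add_mem (ha s hs) (hb s hs)
    | hmul a b ha hb => intro s hs; rw [mul_assoc]; exact ha _ (hb s hs)
  refine (Submodule.eq_top_iff').2 fun a => ?_
  simpa using key a 1 (by simpa using hS 0 0)

variable {V : Type*} [AddCommGroup V] [Module k V]

/-- Linear maps that intertwine the multiplication by `g` with a given operator are determined by
their values on the powers of `x`. -/
theorem gLinear_ext {H H' : TaftAlgebra hω →ₗ[k] V} (Γ : V →ₗ[k] V)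
    (hH : ∀ a, H (g hω * a) = Γ (H a)) (hH' : ∀ a, H' (g hω * a) = Γ (H' a))
    (h : ∀ c < n, H (x hω ^ c) = H' (x hω ^ c)) : H = H' := by
  refine LinearMap.ext_on (span_g_pow_mul_x_pow hω) ?_
  rintro _ ⟨⟨i, c⟩, rfl⟩
  dsimp only
  induction i with
  | zero =>
    rw [pow_zero, one_mul]
    by_cases hc : c < n
    · exact h c hc
    · rw [x_pow_of_le hω (not_lt.1 hc), map_zero, map_zero]
  | succ i ih => rw [pow_succ', mul_assoc, hH, hH', ih]

/-- Linear maps that intertwine the multiplication by `g` with a given operator can be prescribed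
on the powers of `x`. -/
theorem exists_gLinear (Γ : Module.End k V) (hΓ : Γ ^ n = 1) (v : ℕ → V) :
    ∃ H : TaftAlgebra hω →ₗ[k] V, (∀ a, H (g hω * a) = Γ (H a)) ∧ ∀ c < n, H (x hω ^ c) = v c := by
  -- The shift `X`, cut off at n, and the operator `G` make the sequences in V a module over the
  -- Taft algebra; the factor (ω⁻¹) ^ c in `G` produces G X = ω X G. Then H a is the entry 0 of a ·
  -- v. The universal property thus prescribes values on monomials with no appeal to their linear
  -- independence.
  set X : Module.End k (ℕ → V) :=
    { toFun := fun w c => if c + 1 < n then w (c + 1) else 0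
      map_add' := by intros; funext c; simp only [Pi.add_apply]; split_ifs <;> simp
      map_smul' := by intros; funext c; simp } with hX
  set G : Module.End k (ℕ → V) :=
    { toFun := fun w c => (ω⁻¹) ^ c • Γ (w c)
      map_add' := by intros; funext c; simp
      map_smul' := by
        intro r w
        funext c
        simp only [Pi.smul_apply, map_smul, RingHom.id_apply]
        exact smul_comm _ _ _ } with hG
  -- The exponent 0 is excluded because the identity does not truncate sequences at n.
  have Xpow : ∀ j, 0 < j → ∀ w c, (X ^ j) w c = if c + j < n then w (c + j) else 0 := by
    intro j hj
    induction j, hj using Nat.le_induction with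
    | base => intro w c; rfl
    | succ j hj ih =>
      intro w c
      rw [pow_succ, Module.End.mul_apply, ih]
      change (if c + j < n then (if c + j + 1 < n then w (c + j + 1) else 0) else 0) = _
      split_ifs <;> first | rfl | omega
  have Gpow : ∀ j w c, (G ^ j) w c = ((ω⁻¹) ^ c) ^ j • (Γ ^ j) (w c) := by
    intro j
    induction j with
    | zero => simp
    | succ j ih =>
      intro w c
      rw [pow_succ, Module.End.mul_apply, ih, pow_succ, pow_succ, Module.End.mul_apply]
      change _ • (Γ ^ j) ((ω⁻¹) ^ c • Γ (w c)) = _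
      rw [map_smul, smul_smul]
  have h1 : G * X = ω • (X * G) := by
    refine LinearMap.ext fun w => funext fun c => ?_
    change (ω⁻¹) ^ c • Γ (if c + 1 < n then w (c + 1) else 0)
      = ω • (if c + 1 < n then (ω⁻¹) ^ (c + 1) • Γ (w (c + 1)) else 0)
    split_ifs
    · rw [smul_smul, pow_succ', ← mul_assoc, mul_inv_cancel₀ (root_ne_zero hω), one_mul]
    · simp
  have h2 : X ^ n = 0 := by
    refine LinearMap.ext fun w => funext fun c => ?_
    rw [Xpow n (NeZero.pos n), if_neg (by omega)]
    rfl
  have h3 : G ^ n = 1 := by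
    refine LinearMap.ext fun w => funext fun c => ?_
    rw [Gpow, hΓ, ← pow_mul, mul_comm, pow_mul, inv_pow_root hω, one_pow, one_smul]
    rfl
  refine ⟨LinearMap.proj 0 ∘ₗ LinearMap.applyₗ v ∘ₗ (lift hω X G h1 h2 h3).toLinearMap, ?_, ?_⟩
  · intro a
    simp only [LinearMap.comp_apply, AlgHom.toLinearMap_apply, map_mul, lift_g,
      LinearMap.applyₗ_apply_apply, Module.End.mul_apply, LinearMap.proj_apply]
    change (ω⁻¹) ^ 0 • Γ _ = _
    rw [pow_zero, one_smul]
  · intro c hc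
    simp only [LinearMap.comp_apply, AlgHom.toLinearMap_apply, map_pow, lift_x,
      LinearMap.applyₗ_apply_apply, LinearMap.proj_apply]
    rcases Nat.eq_zero_or_pos c with rfl | h
    · simp
    · rw [Xpow c h, zero_add, if_pos hc]

/-- The twist is forced: the coefficient is read to the right of x ^ (n - 1), and g x ^ (n - 1) =
ω⁻¹ x ^ (n - 1) g because ω ^ n = 1. -/
theorem exists_topCoeff : ∃ U : TaftAlgebra hω →ₗ[k] TaftAlgebra hω,
    (∀ a, U (g hω * a) = LinearMap.mulLeft k (ω⁻¹ • g hω) (U a)) ∧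
      ∀ c < n, U (x hω ^ c) = if c + 1 = n then 1 else 0 :=
  exists_gLinear hω _ (pow_mulLeft_g hω _ (inv_pow_root hω)) fun c => if c + 1 = n then 1 else 0

/-- The linear map `x ^ c g ^ i ↦ g ^ i` for `c = n - 1`, and `x ^ c g ^ i ↦ 0` for `c < n - 1`. -/
noncomputable def topCoeff : TaftAlgebra hω →ₗ[k] TaftAlgebra hω := (exists_topCoeff hω).choose

theorem topCoeff_g_mul (a : TaftAlgebra hω) :
    topCoeff hω (g hω * a) = ω⁻¹ • (g hω * topCoeff hω a) := by
  rw [topCoeff, (exists_topCoeff hω).choose_spec.1, LinearMap.mulLeft_apply, smul_mul_assoc]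

theorem topCoeff_x_pow {c : ℕ} (hc : c < n) :
    topCoeff hω (x hω ^ c) = if c + 1 = n then 1 else 0 :=
  (exists_topCoeff hω).choose_spec.2 c hc

theorem topCoeff_x_pow_mul_g_mul (c : ℕ) (a : TaftAlgebra hω) :
    topCoeff hω (x hω ^ c * (g hω * a))
      = (ω⁻¹) ^ (c + 1) • (g hω * topCoeff hω (x hω ^ c * a)) := by
  rw [← mul_assoc, x_pow_mul_g, smul_mul_assoc, map_smul, mul_assoc, topCoeff_g_mul, smul_smul,
    pow_succ]

/-- The two twists add up to an exponent independent of j; for m = n - 1 it is n, and the scalar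
disappears. -/
theorem inv_pow_sub_mul {j m : ℕ} (h : j ≤ m) (b : TaftAlgebra hω) :
    x hω ^ (m - j) * ((ω⁻¹) ^ (j + 1) • (g hω * b))
      = (ω⁻¹) ^ (m + 1) • (g hω * (x hω ^ (m - j) * b)) := by
  rw [mul_smul_comm, ← mul_assoc, x_pow_mul_g, smul_mul_assoc, smul_smul, ← pow_add, mul_assoc]
  congr 2
  omega

/-- Expansion of an element along the powers of `x`. -/
theorem sum_x_pow_mul_topCoeff (b : TaftAlgebra hω) :
    ∑ j ∈ Finset.range n, x hω ^ (n - 1 - j) * topCoeff hω (x hω ^ j * b) = b := by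
  have hn := NeZero.pos n
  have key : (∑ j ∈ Finset.range n, LinearMap.mulLeft k (x hω ^ (n - 1 - j)) ∘ₗ topCoeff hω ∘ₗ
      LinearMap.mulLeft k (x hω ^ j)) = LinearMap.id := by
    refine gLinear_ext hω (LinearMap.mulLeft k (g hω)) ?_ ?_ ?_
    · intro a
      simp only [LinearMap.sum_apply, LinearMap.comp_apply, LinearMap.mulLeft_apply, Finset.mul_sum]
      refine Finset.sum_congr rfl fun j hj => ?_
      rw [Finset.mem_range] at hj
      rw [topCoeff_x_pow_mul_g_mul, inv_pow_sub_mul hω (by omega), Nat.sub_add_cancel hn,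
        inv_pow_root hω, one_smul]
    · intro a; rfl
    · intro c hc
      simp only [LinearMap.sum_apply, LinearMap.comp_apply, LinearMap.mulLeft_apply, ← pow_add,
        LinearMap.id_apply]
      -- For smaller j the product x ^ (j + c) misses the top power, and for larger j it vanishes.
      rw [Finset.sum_eq_single_of_mem (n - 1 - c) (Finset.mem_range.2 (by omega))]
      · rw [topCoeff_x_pow hω (by omega), if_pos (by omega), mul_one]
        congr 1
        omega
      · intro j _ hj
        by_cases h : j + c < n
        · rw [topCoeff_x_pow hω h, if_neg (by omega), mul_zero]
        · rw [x_pow_of_le hω (c := j + c) (by omega), map_zero, mul_zero]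
  have := LinearMap.congr_fun key b
  simpa [LinearMap.sum_apply] using this

/-- The Hochschild cocycle `(a, b) ↦ (a b) / x ^ n`. -/
theorem exists_carry : ∃ Z : TaftAlgebra hω →ₗ[k] TaftAlgebra hω →ₗ[k] TaftAlgebra hω,
    (∀ a b, Z (g hω * a) b = g hω * Z a b) ∧
      ∀ c < n, ∀ b, Z (x hω ^ c) b
        = ∑ j ∈ Finset.range c, x hω ^ (c - 1 - j) * topCoeff hω (x hω ^ j * b) := by
  have hcomp : ∀ j, ((LinearMap.compRight k (LinearMap.mulLeft k (g hω)) :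
      Module.End k (TaftAlgebra hω →ₗ[k] TaftAlgebra hω)) ^ j)
        = LinearMap.compRight k (LinearMap.mulLeft k (g hω ^ j)) := by
    intro j
    induction j with
    | zero => ext; simp
    | succ j ih =>
      rw [pow_succ, ih]
      ext
      simp [pow_succ]
  obtain ⟨Z, h1, h2⟩ := exists_gLinear hω
    (V := TaftAlgebra hω →ₗ[k] TaftAlgebra hω)
    (LinearMap.compRight k (LinearMap.mulLeft k (g hω)))
    (by rw [hcomp, g_pow]; ext; simp)
    (fun c => ∑ j ∈ Finset.range c, LinearMap.mulLeft k (x hω ^ (c - 1 - j)) ∘ₗ topCoeff hω ∘ₗ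
      LinearMap.mulLeft k (x hω ^ j))
  refine ⟨Z, fun a b => ?_, fun c hc b => ?_⟩
  · rw [h1]; rfl
  · rw [h2 c hc, LinearMap.sum_apply]; rfl

/-- A choice of the cocycle `(a, b) ↦ (a b) / x ^ n`. -/
noncomputable def carry : TaftAlgebra hω →ₗ[k] TaftAlgebra hω →ₗ[k] TaftAlgebra hω :=
  (exists_carry hω).choose

theorem carry_g_mul (a b : TaftAlgebra hω) : carry hω (g hω * a) b = g hω * carry hω a b :=
  (exists_carry hω).choose_spec.1 a b

theorem carry_x_pow {c : ℕ} (hc : c < n) (b : TaftAlgebra hω) :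
    carry hω (x hω ^ c) b
      = ∑ j ∈ Finset.range c, x hω ^ (c - 1 - j) * topCoeff hω (x hω ^ j * b) :=
  (exists_carry hω).choose_spec.2 c hc b

theorem carry_one (b : TaftAlgebra hω) : carry hω 1 b = 0 := by
  have := carry_x_pow hω (NeZero.pos n) b
  simpa using this

theorem carry_x (hn : 2 ≤ n) (b : TaftAlgebra hω) : carry hω (x hω) b = topCoeff hω b := by
  have := carry_x_pow hω (c := 1) (by omega) b
  simpa using this

/-- This is the Hochschild cocycle identity of `carry` at (x, b, c), since `carry` at x is
`topCoeff`. Both sides are twisted-linear over k[g] in b, so b = x ^ i suffices. There the sums for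
i and i + 1 cancel, except at i = n - 1, where x ^ n = 0 leaves the whole expansion of c. -/
theorem carry_cocycle (hn : 2 ≤ n) (b c : TaftAlgebra hω) :
    x hω * carry hω b c - carry hω (x hω * b) c + topCoeff hω (b * c) = topCoeff hω b * c := by
  have key : LinearMap.mulLeft k (x hω) ∘ₗ (carry hω).flip c
      - (carry hω).flip c ∘ₗ LinearMap.mulLeft k (x hω)
      + topCoeff hω ∘ₗ LinearMap.mulRight k c = LinearMap.mulRight k c ∘ₗ topCoeff hω := by
    refine gLinear_ext hω (LinearMap.mulLeft k (ω⁻¹ • g hω)) ?_ ?_ ?_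
    · intro a
      simp only [LinearMap.add_apply, LinearMap.sub_apply, LinearMap.comp_apply,
        LinearMap.flip_apply, LinearMap.mulLeft_apply, LinearMap.mulRight_apply, carry_g_mul,
        mul_assoc, topCoeff_g_mul, smul_mul_assoc, mul_add, mul_sub]
      rw [← mul_assoc (x hω) (g hω), x_mul_g, ← mul_assoc (x hω) (g hω), x_mul_g]
      simp only [smul_mul_assoc, map_smul, LinearMap.smul_apply, mul_assoc, carry_g_mul]
    · intro a
      simp only [LinearMap.comp_apply, LinearMap.mulLeft_apply, LinearMap.mulRight_apply,
        topCoeff_g_mul, smul_mul_assoc, mul_assoc]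
    · intro i hi
      simp only [LinearMap.add_apply, LinearMap.sub_apply, LinearMap.comp_apply,
        LinearMap.flip_apply, LinearMap.mulLeft_apply, LinearMap.mulRight_apply, ← pow_succ']
      have hx : x hω * carry hω (x hω ^ i) c
          = ∑ j ∈ Finset.range i, x hω ^ (i - j) * topCoeff hω (x hω ^ j * c) := by
        rw [carry_x_pow hω hi, Finset.mul_sum]
        refine Finset.sum_congr rfl fun j hj => ?_
        rw [Finset.mem_range] at hj
        rw [← mul_assoc, ← pow_succ', show i - 1 - j + 1 = i - j by omega]
      have hs : x hω * carry hω (x hω ^ i) c + topCoeff hω (x hω ^ i * c)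
          = ∑ j ∈ Finset.range (i + 1), x hω ^ (i - j) * topCoeff hω (x hω ^ j * c) := by
        rw [Finset.sum_range_succ, hx]
        simp
      rw [sub_add_eq_add_sub, hs, topCoeff_x_pow hω hi]
      split_ifs with h
      · subst h
        rw [x_pow, map_zero, LinearMap.zero_apply, sub_zero, one_mul]
        exact sum_x_pow_mul_topCoeff hω c
      · rw [carry_x_pow hω (by omega), zero_mul, sub_eq_zero]
        rfl
  exact LinearMap.congr_fun key b

theorem topCoeff_scale (t : k) (a : TaftAlgebra hω) :
    topCoeff hω (scale hω t a) = t ^ (n - 1) • scale hω t (topCoeff hω a) := by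
  have key : topCoeff hω ∘ₗ (scale hω t).toLinearMap
      = t ^ (n - 1) • (scale hω t).toLinearMap ∘ₗ topCoeff hω := by
    refine gLinear_ext hω (LinearMap.mulLeft k (ω⁻¹ • g hω)) ?_ ?_ ?_
    · intro a
      simp [topCoeff_g_mul]
    · intro a
      simp only [LinearMap.smul_apply, LinearMap.comp_apply, AlgHom.toLinearMap_apply,
        topCoeff_g_mul, map_smul, map_mul, scale_g, LinearMap.mulLeft_apply, smul_mul_assoc]
    · intro c hc
      simp only [LinearMap.comp_apply, AlgHom.toLinearMap_apply, scale_x_pow, map_smul,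
        LinearMap.smul_apply]
      rw [topCoeff_x_pow hω hc]
      split_ifs with h
      · subst h; simp
      · simp
  exact LinearMap.congr_fun key a

/-- In all, n factors x are removed: n - 1 by `topCoeff`, and one because the outer and inner
exponents c - 1 - j and j add up to c - 1. -/
theorem carry_scale (t : k) (a b : TaftAlgebra hω) :
    carry hω (scale hω t a) (scale hω t b) = t ^ n • scale hω t (carry hω a b) := by
  have key : (carry hω).flip (scale hω t b) ∘ₗ (scale hω t).toLinearMap
      = t ^ n • (scale hω t).toLinearMap ∘ₗ (carry hω).flip b := by
    refine gLinear_ext hω (LinearMap.mulLeft k (g hω)) ?_ ?_ ?_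
    · intro a
      simp [carry_g_mul]
    · intro a
      simp [carry_g_mul]
    · intro c hc
      simp only [LinearMap.comp_apply, AlgHom.toLinearMap_apply, scale_x_pow, map_smul,
        LinearMap.smul_apply, LinearMap.flip_apply, carry_x_pow hω hc, map_sum, Finset.smul_sum,
        map_mul]
      refine Finset.sum_congr rfl fun j hj => ?_
      rw [Finset.mem_range] at hj
      have h1 : t ^ j • (x hω ^ j * scale hω t b) = scale hω t (x hω ^ j * b) := by
        rw [map_mul, scale_x_pow, smul_mul_assoc]
      have hn := NeZero.pos n
      -- The factor t ^ j is absorbed into the argument of `topCoeff`; no division occurs, so t = 0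
      -- is allowed.
      have e : t ^ c = t ^ (c - j) * t ^ j := by rw [← pow_add]; congr 1; omega
      rw [e, mul_smul, ← mul_smul_comm, ← map_smul, h1, topCoeff_scale, mul_smul_comm,
        smul_mul_assoc, smul_smul, smul_smul, ← pow_add, ← pow_add]
      congr 2
      omega
  exact LinearMap.congr_fun key a

end Linear

end TaftAlgebra

namespace BarCochain

/-! ### Calculus of homogeneous cochains. -/

section Equivariant

variable {k A M : Type*} [Field k] [Ring A] [Algebra k A] [AddCommGroup M] [Module k M]

/-- Cochains `f` with `f (σ a₁, …, σ aₘ) = c τ (f (a₁, …, aₘ))`. -/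
def Equivariant (σ : A →ₐ[k] A) (τ : M →ₗ[k] M) (c : k) {m : ℕ} (f : BarCochain k A M m) : Prop :=
  pull σ.toLinearMap f = c • push τ f

variable {σ : A →ₐ[k] A} {τ : M →ₗ[k] M} {c : k} {m : ℕ}

theorem equivariant_iff_cur {f : BarCochain k A M (m + 1)} :
    Equivariant σ τ c f ↔ ∀ a, pull σ.toLinearMap (cur f (σ a)) = c • push τ (cur f a) := by
  constructor
  · intro h a
    have := congrArg (fun ψ => cur ψ a) h
    simpa only [cur_pull, map_smul, LinearMap.smul_apply, cur_push,
      AlgHom.toLinearMap_apply] using this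
  · intro h
    refine cur_ext fun a => ?_
    rw [cur_pull, map_smul, LinearMap.smul_apply, cur_push]
    exact h a

theorem Equivariant.sub {f g : BarCochain k A M m} (hf : Equivariant σ τ c f)
    (hg : Equivariant σ τ c g) : Equivariant σ τ c (f - g) := by
  unfold Equivariant at *
  rw [map_sub, hf, hg, map_sub, smul_sub]

theorem Equivariant.add {f g : BarCochain k A M m} (hf : Equivariant σ τ c f)
    (hg : Equivariant σ τ c g) : Equivariant σ τ c (f + g) := by
  unfold Equivariant at *
  rw [map_add, hf, hg, map_add, smul_add]

theorem Equivariant.smul {f : BarCochain k A M m} (r : k) (hf : Equivariant σ τ c f) :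
    Equivariant σ τ c (r • f) := by
  unfold Equivariant at *
  rw [map_smul, hf, map_smul, smul_comm]

theorem equivariant_zero : Equivariant σ τ c (0 : BarCochain k A M m) := by
  unfold Equivariant
  rw [map_zero, map_zero, smul_zero]

theorem Equivariant.sum {ι : Type*} {s : Finset ι} {f : ι → BarCochain k A M m}
    (hf : ∀ i ∈ s, Equivariant σ τ c (f i)) : Equivariant σ τ c (∑ i ∈ s, f i) := by
  unfold Equivariant at *
  rw [map_sum, map_sum, Finset.smul_sum]
  exact Finset.sum_congr rfl hf

theorem Equivariant.lact {L R : A →ₗ[k] M →ₗ[k] M} (H : IsSemilinear L R σ τ)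
    {f : BarCochain k A M m} (hf : Equivariant σ τ c f) {a : A} {r : k} (ha : σ a = r • a)
    {c' : k} (hc : c' * r = c) : Equivariant σ τ c' (lact L a f) := by
  unfold Equivariant at *
  rw [pull_lact, hf, H.push_lact, ha, map_smul, map_smul, LinearMap.smul_apply, smul_smul, hc]

/-- Filling a slot with an eigenvector divides the factor by its eigenvalue. With a = x ^ j under
`scale` the degree drops by j, just as it does when x ^ j acts on the values. -/
theorem Equivariant.cur {f : BarCochain k A M (m + 1)} (hf : Equivariant σ τ c f) {a : A} {r : k}
    (ha : σ a = r • a) {c' : k} (hc : r * c' = c) (hr : r ≠ 0) :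
    Equivariant σ τ c' (cur f a) := by
  have := equivariant_iff_cur.1 hf a
  rw [ha, map_smul, map_smul, ← hc, mul_smul] at this
  exact (smul_right_injective _ hr) this

theorem Equivariant.d {L R : A →ₗ[k] M →ₗ[k] M} (H : IsSemilinear L R σ τ)
    {f : BarCochain k A M m} (hf : Equivariant σ τ c f) : Equivariant σ τ c (d L R m f) :=
  H.pull_d hf

end Equivariant

/-! ### Normalizing cocycles of the Taft algebra. -/

section Taft

open TaftAlgebra

variable {k : Type*} [Field k] {n : ℕ} {ω : k} {hω : IsPrimitiveRoot ω n}
  {M : Type*} [AddCommGroup M] [Module k M]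
  {L R : TaftAlgebra hω →ₗ[k] M →ₗ[k] M} {τ : M →ₗ[k] M} {m : ℕ}

/-- The cocycle identity with its first two variables isolated. Taken at a = x it is the source of
the recursions along the powers of x below. -/
theorem cur_dRight_cur {f : BarCochain k (TaftAlgebra hω) M (m + 1)} (hf : d L R (m + 1) f = 0)
    (a b : TaftAlgebra hω) :
    cur (dRight R m (cur f a)) b = lact L a (cur f b) - cur f (a * b) := by
  have := cur_cur_d L R f a b
  rw [hf, map_zero, LinearMap.zero_apply, map_zero, LinearMap.zero_apply] at this
  rw [eq_comm, ← sub_eq_zero, ← this]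

/-- Cochains that are linear over `k[g]` in the first variable and vanish if it is `1`. -/
structure GNormal (L : TaftAlgebra hω →ₗ[k] M →ₗ[k] M)
    (f : BarCochain k (TaftAlgebra hω) M (m + 1)) : Prop where
  g_mul : ∀ a, cur f (g hω * a) = lact L (g hω) (cur f a)
  one : cur f 1 = 0

theorem GNormal.sub {f f' : BarCochain k (TaftAlgebra hω) M (m + 1)} (hf : GNormal L f)
    (hf' : GNormal L f') : GNormal L (f - f') :=
  ⟨fun a => by simp only [map_sub, LinearMap.sub_apply, hf.g_mul, hf'.g_mul],
    by simp only [map_sub, LinearMap.sub_apply, hf.one, hf'.one, sub_zero]⟩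

/-- Ensures that later corrections, by coboundaries of normalized cochains, do not destroy the
normalization already reached. -/
theorem GNormal.d (HB : IsBimodule L R) {f : BarCochain k (TaftAlgebra hω) M (m + 1)}
    (hf : GNormal L f) : GNormal L (d L R (m + 1) f) := by
  constructor
  · intro a
    refine cur_ext fun b => ?_
    rw [cur_lact, cur_cur_d, cur_cur_d, hf.g_mul, mul_assoc, hf.g_mul, HB.dRight_lact, cur_lact,
      HB.lact_mul, map_sub, map_sub]
  · refine cur_ext fun b => ?_
    rw [cur_cur_d, hf.one, one_mul, HB.lact_one]
    simp

theorem IsBimodule.lact_pow (HB : IsBimodule L R) (a : TaftAlgebra hω) (j : ℕ) :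
    (lact L a : Module.End k (BarCochain k (TaftAlgebra hω) M m)) ^ j = lact L (a ^ j) := by
  induction j with
  | zero => ext1 φ; rw [pow_zero, pow_zero, HB.lact_one]; rfl
  | succ j ih => ext1 φ; rw [pow_succ, ih, pow_succ, HB.lact_mul]; rfl

theorem g_pow_pred_pow : (g hω ^ (n - 1)) ^ n = 1 := by
  rw [← pow_mul, mul_comm, pow_mul, g_pow, one_pow]

/-- Averaging over the powers of `g`, twisted by the scalar `r`. -/
noncomputable def average (L : TaftAlgebra hω →ₗ[k] M →ₗ[k] M) (r : k)
    (f : BarCochain k (TaftAlgebra hω) M (m + 1)) : BarCochain k (TaftAlgebra hω) M (m + 1) :=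
  cur.symm ((n : k)⁻¹ • ∑ s ∈ Finset.range n,
    lact L ((r • g hω) ^ s) ∘ₗ cur f ∘ₗ LinearMap.mulLeft k ((g hω ^ (n - 1)) ^ s))

theorem cur_average (r : k) (f : BarCochain k (TaftAlgebra hω) M (m + 1)) (b : TaftAlgebra hω) :
    cur (average L r f) b = (n : k)⁻¹ • ∑ s ∈ Finset.range n,
      lact L ((r • g hω) ^ s) (cur f ((g hω ^ (n - 1)) ^ s * b)) := by
  rw [average, LinearEquiv.apply_symm_apply, LinearMap.smul_apply, LinearMap.sum_apply]
  rfl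

variable {t : k}

theorem equivariant_cur_average (HS : IsSemilinear L R (scale hω t) τ) {r c : k}
    {f : BarCochain k (TaftAlgebra hω) M (m + 1)} (hf : Equivariant (scale hω t) τ c f) :
    Equivariant (scale hω t) τ c (cur (average L r f) 1) := by
  rw [cur_average]
  refine Equivariant.smul _ (Equivariant.sum fun s _ => ?_)
  refine Equivariant.lact HS (r := 1) (c := c) ?_ (by simp) (mul_one c)
  exact hf.cur (r := 1) (by simp) (one_mul c) one_ne_zero

variable [NeZero n]

/-- A normalized cocycle is determined by its value at `x`. -/
theorem GNormal.eq_zero {f : BarCochain k (TaftAlgebra hω) M (m + 1)}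
    (hf : GNormal L f) (hd : BarCochain.d L R (m + 1) f = 0) (hx : cur f (x hω) = 0) : f = 0 := by
  refine cur.injective ?_
  rw [map_zero]
  refine gLinear_ext hω (lact L (g hω)) hf.g_mul (by simp) fun c _ => ?_
  rw [LinearMap.zero_apply]
  induction c with
  | zero => rw [pow_zero, hf.one]
  | succ c ih =>
    -- At (x, x ^ c) the cocycle identity expresses the value at x ^ (c + 1) through those at x ^ c
    -- and at x.
    have := cur_dRight_cur hd (x hω) (x hω ^ c)
    rw [hx, map_zero, map_zero, LinearMap.zero_apply, ih (by omega), map_zero, zero_sub,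
      eq_comm, neg_eq_zero] at this
    rw [pow_succ', this]

theorem exists_gLinear_cochain (HB : IsBimodule L R)
    (v : ℕ → BarCochain k (TaftAlgebra hω) M m) :
    ∃ h : BarCochain k (TaftAlgebra hω) M (m + 1),
      (∀ a, cur h (g hω * a) = lact L (g hω) (cur h a)) ∧ ∀ c < n, cur h (x hω ^ c) = v c := by
  obtain ⟨h, h1, h2⟩ := exists_gLinear hω (lact L (g hω))
    (by rw [HB.lact_pow, g_pow]; ext1 φ; exact HB.lact_one φ) v
  exact ⟨cur.symm h, by simpa using h1, by simpa using h2⟩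

/-- Scaling fixes g, so both sides of the homogeneity equation are k[g]-linear in the first variable
and may be compared on powers of x. -/
theorem equivariant_of_gLinear (HS : IsSemilinear L R (scale hω t) τ) (ht : t ≠ 0) {c : k}
    {h : BarCochain k (TaftAlgebra hω) M (m + 1)}
    (h1 : ∀ a, cur h (g hω * a) = lact L (g hω) (cur h a))
    (h2 : ∀ j < n, Equivariant (scale hω t) τ (c * (t⁻¹) ^ j) (cur h (x hω ^ j))) :
    Equivariant (scale hω t) τ c h := by
  rw [equivariant_iff_cur]
  have key : pull (scale hω t).toLinearMap ∘ₗ cur h ∘ₗ (scale hω t).toLinearMap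
      = c • push τ ∘ₗ (cur h : _ →ₗ[k] _) := by
    refine gLinear_ext hω (lact L (g hω)) ?_ ?_ ?_
    · intro a
      simp only [LinearMap.comp_apply, AlgHom.toLinearMap_apply, map_mul, scale_g, h1, pull_lact]
    · intro a
      simp only [LinearMap.comp_apply, LinearMap.smul_apply, h1, HS.push_lact, scale_g, map_smul]
    · intro j hj
      simp only [LinearMap.comp_apply, AlgHom.toLinearMap_apply, LinearMap.smul_apply,
        scale_x_pow, map_smul]
      have := h2 j hj
      unfold Equivariant at this
      rw [this, smul_smul, mul_left_comm, ← mul_pow, mul_inv_cancel₀ ht, one_pow, mul_one]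
  exact LinearMap.congr_fun key

/-- Acting by r g moves each summand to the next, and r ^ n = g ^ n = 1 closes the cycle. -/
theorem cur_average_g_mul (HB : IsBimodule L R) {r : k} (hr : r ^ n = 1)
    (f : BarCochain k (TaftAlgebra hω) M (m + 1)) (b : TaftAlgebra hω) :
    cur (average L r f) (g hω * b) = lact L (r • g hω) (cur (average L r f) b) := by
  rw [cur_average, cur_average, map_smul, map_sum]
  congr 1
  set Y : ℕ → BarCochain k (TaftAlgebra hω) M m := fun s =>
    lact L ((r • g hω) ^ s) (cur f ((g hω ^ (n - 1)) ^ s * (g hω * b))) with hY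
  have h1 : ∀ s, lact L (r • g hω) (lact L ((r • g hω) ^ s) (cur f ((g hω ^ (n - 1)) ^ s * b)))
      = Y (s + 1) := by
    intro s
    rw [hY, ← HB.lact_mul, ← pow_succ']
    dsimp only
    rw [pow_succ (g hω ^ (n - 1)), mul_assoc _ _ (g hω * b), ← mul_assoc _ (g hω) b, g_pow_mul_g,
      one_mul]
  have h2 : Y n = Y 0 := by
    simp only [hY, smul_pow, hr, g_pow, g_pow_pred_pow, one_smul, pow_zero]
  have h3 := Finset.sum_range_succ' Y n
  rw [Finset.sum_range_succ, h2, add_left_inj] at h3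
  rw [h3]
  exact Finset.sum_congr rfl fun s _ => (h1 s).symm

/-- The values of h at the powers of x are free. Requiring f - d h to vanish at (x, x ^ c) for c < n
- 1 is a recursion for h (x ^ (c + 1)), started at 0. At c = n - 1 no freedom is left, since x ^ n =
0, and the value found there is φ. -/
theorem exists_gNormal_topCoeff (HB : IsBimodule L R) (hn : 2 ≤ n)
    {f : BarCochain k (TaftAlgebra hω) M (m + 2)}
    (hg : ∀ b, cur (cur f (x hω)) (g hω * b) = lact L (ω⁻¹ • g hω) (cur (cur f (x hω)) b))
    (h1 : cur (cur f (x hω)) 1 = 0) :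
    ∃ h : BarCochain k (TaftAlgebra hω) M (m + 1), GNormal L h ∧
      (∃ φ, ∀ b, cur (cur (f - d L R (m + 1) h) (x hω)) b = lact L (topCoeff hω b) φ) ∧
      ∀ (t : k) (τ : M →ₗ[k] M) (c : k), t ≠ 0 → IsSemilinear L R (scale hω t) τ →
        Equivariant (scale hω t) τ c f → Equivariant (scale hω t) τ c h := by
  set F := cur f (x hω) with hF
  set v : ℕ → BarCochain k (TaftAlgebra hω) M m := fun c =>
    Nat.rec 0 (fun c u => lact L (x hω) u - cur F (x hω ^ c)) c with hv
  have v0 : v 0 = 0 := rfl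
  have vs : ∀ c, v (c + 1) = lact L (x hω) (v c) - cur F (x hω ^ c) := fun c => rfl
  obtain ⟨h, hh, h2⟩ := exists_gLinear_cochain HB v
  have e0 : cur h 1 = 0 := by simpa [v0] using h2 0 (by omega)
  -- Here `h1` enters: because h vanishes at x, the term of d h that differentiates h (x, ·) drops
  -- out.
  have ex : cur h (x hω) = 0 := by simpa [vs, v0, h1] using h2 1 (by omega)
  have hcur : ∀ b, cur (cur (f - d L R (m + 1) h) (x hω)) b
      = cur F b - lact L (x hω) (cur h b) + cur h (x hω * b) := by
    intro b
    rw [map_sub, LinearMap.sub_apply, map_sub, LinearMap.sub_apply, cur_cur_d, ex, map_zero,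
      map_zero, LinearMap.zero_apply, ← hF]
    abel
  refine ⟨h, ⟨hh, e0⟩, ⟨cur (cur (f - d L R (m + 1) h) (x hω)) (x hω ^ (n - 1)), ?_⟩, ?_⟩
  · set φ := cur (cur (f - d L R (m + 1) h) (x hω)) (x hω ^ (n - 1)) with hφ
    have key : (cur (cur (f - d L R (m + 1) h) (x hω)) : _ →ₗ[k] _)
        = (lact L).flip φ ∘ₗ topCoeff hω := by
      refine gLinear_ext hω (lact L (ω⁻¹ • g hω)) ?_ ?_ ?_
      · intro b
        rw [hcur, hcur, hg, hh, ← mul_assoc, x_mul_g, ← HB.lact_mul, x_mul_g,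
          smul_mul_assoc, map_smul (cur h), mul_assoc, hh, map_add, map_sub, ← HB.lact_mul,
          smul_mul_assoc]
        simp only [map_smul, LinearMap.smul_apply]
      · intro b
        simp only [LinearMap.comp_apply, LinearMap.flip_apply, topCoeff_g_mul, map_smul,
          LinearMap.smul_apply, HB.lact_mul]
      · intro c hc
        rw [LinearMap.comp_apply, LinearMap.flip_apply, topCoeff_x_pow hω hc]
        split_ifs with hc'
        · obtain rfl : c = n - 1 := by omega
          rw [HB.lact_one, hφ]
        · rw [hcur, ← pow_succ', h2 c hc, h2 (c + 1) (by omega), vs]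
          simp
    exact LinearMap.congr_fun key
  · intro t τ c ht HS hE
    refine equivariant_of_gLinear HS ht hh fun j hj => ?_
    rw [h2 j hj]
    clear hj
    induction j with
    | zero => rw [v0]; exact equivariant_zero
    | succ j ih =>
      rw [vs]
      refine Equivariant.sub (ih.lact HS (scale_x hω t) ?_) ?_
      · rw [pow_succ]; field_simp
      · refine Equivariant.cur (c := c * t⁻¹) ?_ (scale_x_pow hω t j) ?_ (pow_ne_zero _ ht)
        · exact hE.cur (scale_x hω t) (by field_simp) ht
        · rw [pow_succ, inv_pow]; field_simp

/-- The cocycle identity is read at (x, x ^ (n - 1), b), where the term at x ^ n is absent. What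
remains besides `dRight` φ is x f (x ^ (n - 1), b) + F (x ^ (n - 1) b). By `hpow` this is the
expansion `sum_x_pow_mul_topCoeff` of b applied to φ, so the identity says d φ = 0 at b. -/
theorem d_eq_zero_of_topCoeff (HB : IsBimodule L R)
    {f : BarCochain k (TaftAlgebra hω) M (m + 2)} (hf : d L R (m + 2) f = 0) (hN : GNormal L f)
    {φ : BarCochain k (TaftAlgebra hω) M m}
    (hφ : ∀ b, cur (cur f (x hω)) b = lact L (topCoeff hω b) φ) : d L R m φ = 0 := by
  have hn := NeZero.pos n
  set F := cur f (x hω) with hF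
  -- The same shape as `carry_x_pow`. The recursion needs F (x ^ c) = 0, which holds as long as c +
  -- 1 < n.
  have hpow : ∀ c < n, ∀ b, cur (cur f (x hω ^ c)) b
      = ∑ j ∈ Finset.range c, lact L (x hω ^ (c - 1 - j)) (cur F (x hω ^ j * b)) := by
    intro c hc b
    induction c with
    | zero => rw [pow_zero, hN.one]; simp
    | succ c ih =>
      have h0 : cur F (x hω ^ c) = 0 := by
        rw [hφ, topCoeff_x_pow hω (by omega), if_neg (by omega), map_zero, LinearMap.zero_apply]
      have h1 := cur_cur_dRight R F (x hω ^ c) b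
      rw [hF, cur_dRight_cur hf, ← hF, h0, map_zero, map_zero, LinearMap.zero_apply, sub_zero,
        ← pow_succ', map_sub, LinearMap.sub_apply, cur_lact, ih (by omega)] at h1
      rw [Finset.sum_range_succ]
      have h2 : ∑ j ∈ Finset.range c, lact L (x hω ^ (c + 1 - 1 - j)) (cur F (x hω ^ j * b))
          = lact L (x hω)
            (∑ j ∈ Finset.range c, lact L (x hω ^ (c - 1 - j)) (cur F (x hω ^ j * b))) := by
        rw [map_sum]
        refine Finset.sum_congr rfl fun j hj => ?_
        rw [Finset.mem_range] at hj
        rw [← HB.lact_mul, ← pow_succ']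
        congr 3
        omega
      rw [h2, Nat.add_sub_cancel, Nat.sub_self, pow_zero, HB.lact_one]
      rw [sub_eq_iff_eq_add] at h1
      rw [h1]
      abel
  refine cur_ext fun b => ?_
  have e1 := cur_cur_dRight R F (x hω ^ (n - 1)) b
  have e2 : cur F (x hω ^ (n - 1)) = φ := by
    rw [hφ, topCoeff_x_pow hω (by omega), if_pos (by omega), HB.lact_one]
  rw [e2, hF, cur_dRight_cur hf, ← hF, ← pow_succ', Nat.sub_add_cancel hn, x_pow, map_zero,
    sub_zero, cur_lact, hpow (n - 1) (by omega)] at e1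
  have e3 : lact L b φ = lact L (x hω) (∑ j ∈ Finset.range (n - 1),
      lact L (x hω ^ (n - 1 - 1 - j)) (cur F (x hω ^ j * b))) + cur F (x hω ^ (n - 1) * b) := by
    conv_lhs => rw [← sum_x_pow_mul_topCoeff hω b]
    obtain ⟨N, hN⟩ : ∃ N, n = N + 1 := ⟨n - 1, by omega⟩
    have hs : ∀ G : ℕ → BarCochain k (TaftAlgebra hω) M m,
        ∑ j ∈ Finset.range n, G j = ∑ j ∈ Finset.range (n - 1), G j + G (n - 1) := by
      intro G
      rw [← Finset.sum_range_succ, Nat.sub_add_cancel hn]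
    rw [map_sum, LinearMap.sum_apply, hs, Nat.sub_self, pow_zero, one_mul, ← hφ, map_sum]
    congr 1
    refine Finset.sum_congr rfl fun j hj => ?_
    rw [Finset.mem_range] at hj
    rw [HB.lact_mul, ← hφ, ← HB.lact_mul, ← pow_succ']
    congr 3
    omega
  rw [cur_d, map_zero, LinearMap.zero_apply, e3, e1]
  abel

/-- The witness is the cup product of `carry` with ψ; by `carry_cocycle` only the differential of ψ
survives at x. A coboundary correction of φ in arity m thereby lifts to a correction of f two
degrees higher. -/
theorem exists_gNormal_carry (HB : IsBimodule L R) (hn : 2 ≤ n)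
    (ψ : BarCochain k (TaftAlgebra hω) M m) :
    ∃ h : BarCochain k (TaftAlgebra hω) M (m + 2), GNormal L h ∧
      (∀ b, cur (cur (d L R (m + 2) h) (x hω)) b = lact L (topCoeff hω b) (d L R m ψ)) ∧
      ∀ (t : k) (τ : M →ₗ[k] M) (c : k), t ≠ 0 → IsSemilinear L R (scale hω t) τ →
        Equivariant (scale hω t) τ (c * (t⁻¹) ^ n) ψ → Equivariant (scale hω t) τ c h := by
  set h : BarCochain k (TaftAlgebra hω) M (m + 2) := cur.symm
    ((cur (k := k) (A := TaftAlgebra hω) (M := M) (m := m)).symm.toLinearMap ∘ₗ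
      LinearMap.compRight k ((lact L).flip ψ) ∘ₗ carry hω) with hh
  have hcur : ∀ a b, cur (cur h a) b = lact L (carry hω a b) ψ := by
    intro a b
    simp [hh]
  have hN : GNormal L h := by
    constructor
    · intro a
      refine cur_ext fun b => ?_
      rw [cur_lact, hcur, hcur, carry_g_mul, HB.lact_mul]
    · refine cur_ext fun b => ?_
      rw [hcur, carry_one, map_zero, map_zero, LinearMap.zero_apply, LinearMap.zero_apply]
  refine ⟨h, hN, fun b => cur_ext fun c => ?_, ?_⟩
  · rw [cur_cur_d, map_sub, LinearMap.sub_apply, map_sub, LinearMap.sub_apply, cur_lact, hcur, hcur,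
      cur_cur_dRight, hcur, hcur, carry_x hω hn, carry_x hω hn, cur_lact, cur_d, map_add,
      HB.dRight_lact, cur_lact, ← HB.lact_mul, ← HB.lact_mul, ← carry_cocycle hω hn]
    simp only [map_add, map_sub, LinearMap.add_apply, LinearMap.sub_apply]
    abel
  · intro t τ c ht HS hE
    rw [equivariant_iff_cur]
    intro a
    refine cur_ext fun b => ?_
    rw [cur_pull, AlgHom.toLinearMap_apply, hcur, pull_lact, hE, map_smul (lact L _), map_smul cur,
      LinearMap.smul_apply, cur_push, hcur, HS.push_lact, carry_scale, map_smul (lact L),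
      LinearMap.smul_apply, smul_smul, mul_assoc, ← mul_pow, inv_mul_cancel₀ ht, one_pow, mul_one]

variable [CharZero k]

/-- Separability of k[g], twisted by r. Applying (r g) ^ s to `hf` turns its first term into f and
its second into the summand of `average`. The sum over s is then divided by n, which is invertible
in characteristic 0. -/
theorem dRight_cur_average (HB : IsBimodule L R) {r : k} (hr : r ^ n = 1)
    {f : BarCochain k (TaftAlgebra hω) M (m + 1)}
    (hf : ∀ s b, cur (dRight R m (cur f ((g hω ^ (n - 1)) ^ s))) b
      = lact L ((r⁻¹ • g hω ^ (n - 1)) ^ s) (cur f b) - cur f ((g hω ^ (n - 1)) ^ s * b)) :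
    dRight R m (cur (average L r f) 1) = f - average L r f := by
  have hr0 : r ≠ 0 := by
    rintro rfl
    rw [zero_pow (NeZero.ne n)] at hr
    exact zero_ne_one hr
  have hinv : ∀ s, (r • g hω) ^ s * (r⁻¹ • g hω ^ (n - 1)) ^ s = 1 := by
    intro s
    have hc : Commute (r • g hω) (r⁻¹ • g hω ^ (n - 1)) :=
      (((Commute.refl (g hω)).pow_right _).smul_left _).smul_right _
    rw [← hc.mul_pow, smul_mul_smul_comm, mul_inv_cancel₀ hr0, g_mul_g_pow, one_smul, one_pow]
  refine cur_ext fun b => ?_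
  rw [map_sub, LinearMap.sub_apply, cur_average, cur_average]
  simp only [mul_one, map_smul, map_sum, LinearMap.smul_apply, LinearMap.sum_apply, HB.dRight_lact,
    cur_lact, hf, map_sub, ← HB.lact_mul, hinv, HB.lact_one, Finset.sum_sub_distrib, smul_sub,
    Finset.sum_const, Finset.card_range]
  rw [← Nat.cast_smul_eq_nsmul k, smul_smul, inv_mul_cancel₀ (NeZero.ne (n : k)), one_smul]

/-- Take h to be the average at 1. Its `dRight` replaces f by the average, which is k[g]-linear; the
left-action term of d h subtracts b · h, which makes the value at 1 vanish. -/
theorem exists_gNormal_sub_d (HB : IsBimodule L R) {f : BarCochain k (TaftAlgebra hω) M (m + 1)}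
    (hf : d L R (m + 1) f = 0) :
    ∃ h : BarCochain k (TaftAlgebra hω) M m, GNormal L (f - d L R m h) ∧
      ∀ (t : k) (τ : M →ₗ[k] M) (c : k), IsSemilinear L R (scale hω t) τ →
        Equivariant (scale hω t) τ c f → Equivariant (scale hω t) τ c h := by
  have key : dRight R m (cur (average L 1 f) 1) = f - average L 1 f := by
    refine dRight_cur_average HB (one_pow n) fun s b => ?_
    rw [cur_dRight_cur hf, inv_one, one_smul]
  have hcur : ∀ b, cur (f - d L R m (cur (average L 1 f) 1)) b
      = cur (average L 1 f) b - lact L b (cur (average L 1 f) 1) := by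
    intro b
    rw [map_sub, LinearMap.sub_apply, cur_d, key, map_sub, LinearMap.sub_apply]
    abel
  refine ⟨cur (average L 1 f) 1, ⟨fun a => ?_, ?_⟩,
    fun t τ c HS h => equivariant_cur_average HS h⟩
  · rw [hcur, hcur, cur_average_g_mul HB (one_pow n), one_smul, HB.lact_mul, map_sub]
  · rw [hcur, HB.lact_one, sub_self]

/-- The averaging argument for F = f (x, ·), twisted by ω⁻¹ because x g = ω⁻¹ g x. Normalization in
the first variable kills f at powers of g, so the hypothesis of `dRight_cur_average` holds for F.
Among the powers of x, h lives on x alone: there it cancels the non-averaged part of F, and the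
remaining terms of d h make the value at 1 vanish. -/
theorem exists_gNormal_second (HB : IsBimodule L R) (hn : 2 ≤ n)
    {f : BarCochain k (TaftAlgebra hω) M (m + 2)} (hf : d L R (m + 2) f = 0) (hN : GNormal L f) :
    ∃ h : BarCochain k (TaftAlgebra hω) M (m + 1), GNormal L h ∧
      (∀ b, cur (cur (f - d L R (m + 1) h) (x hω)) (g hω * b)
        = lact L (ω⁻¹ • g hω) (cur (cur (f - d L R (m + 1) h) (x hω)) b)) ∧
      cur (cur (f - d L R (m + 1) h) (x hω)) 1 = 0 ∧
      ∀ (t : k) (τ : M →ₗ[k] M) (c : k), t ≠ 0 → IsSemilinear L R (scale hω t) τ →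
        Equivariant (scale hω t) τ c f → Equivariant (scale hω t) τ c h := by
  set F := cur f (x hω) with hF
  have hω' := inv_pow_root hω
  have hgs : ∀ s, cur f (g hω ^ s) = 0 := by
    intro s
    induction s with
    | zero => rw [pow_zero, hN.one]
    | succ s ih => rw [pow_succ', hN.g_mul, ih, map_zero]
  have hgs' : ∀ s b, cur f (g hω ^ s * b) = lact L (g hω ^ s) (cur f b) := by
    intro s b
    induction s with
    | zero => rw [pow_zero, one_mul, HB.lact_one]
    | succ s ih => rw [pow_succ', mul_assoc, hN.g_mul, ih, HB.lact_mul]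
  have key : dRight R m (cur (average L ω⁻¹ F) 1) = F - average L ω⁻¹ F := by
    refine dRight_cur_average HB hω' fun s b => ?_
    have h1 := cur_cur_dRight R F ((g hω ^ (n - 1)) ^ s) b
    rw [hF, cur_dRight_cur hf, ← hF, ← pow_mul, hgs, map_zero, zero_sub, map_neg,
      LinearMap.neg_apply, x_mul_g_pow', map_smul, map_smul, LinearMap.smul_apply, hgs',
      cur_lact, ← hF] at h1
    -- The scalar picked up when x passes g ^ ((n - 1) s), which is g to the power -s.
    have h2 : (ω⁻¹) ^ ((n - 1) * s) = ω ^ s := by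
      have h3 : ω⁻¹ ^ (n - 1) * ω⁻¹ = 1 := by
        rw [← pow_succ, Nat.sub_add_cancel (NeZero.pos n), hω']
      rw [pow_mul, eq_inv_of_mul_eq_one_left h3, inv_inv]
    rw [inv_inv, smul_pow, ← pow_mul, map_smul, LinearMap.smul_apply, ← h2]
    rw [eq_sub_iff_add_eq] at h1
    rw [eq_sub_iff_add_eq, ← neg_inj, neg_add, ← h1]
    abel
  obtain ⟨h, h1, h2⟩ := exists_gLinear_cochain (m := m) HB
    (fun c => if c = 1 then -cur (average L ω⁻¹ F) 1 else 0)
  have h0 : cur h 1 = 0 := by simpa using h2 0 (by omega)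
  have hx : cur h (x hω) = -cur (average L ω⁻¹ F) 1 := by simpa using h2 1 (by omega)
  have hcur : ∀ b, cur (cur (f - d L R (m + 1) h) (x hω)) b
      = cur (average L ω⁻¹ F) b - lact L (x hω) (cur h b) + cur h (x hω * b) := by
    intro b
    rw [map_sub, LinearMap.sub_apply, map_sub, LinearMap.sub_apply, cur_cur_d, hx, map_neg, key,
      ← hF, map_neg, map_sub, LinearMap.neg_apply, LinearMap.sub_apply]
    abel
  refine ⟨h, ⟨h1, h0⟩, ?_, ?_, ?_⟩
  · intro b
    rw [hcur, hcur, cur_average_g_mul HB hω', h1, ← mul_assoc, x_mul_g, ← HB.lact_mul, x_mul_g,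
      smul_mul_assoc, map_smul (cur h), mul_assoc, h1, map_add, map_sub, ← HB.lact_mul,
      smul_mul_assoc]
    simp only [map_smul, LinearMap.smul_apply]
  · rw [hcur, h0, mul_one, hx, map_zero]
    abel
  · intro t τ c ht HS hE
    refine equivariant_of_gLinear HS ht h1 fun j hj => ?_
    rw [h2 j hj]
    split_ifs with h
    · subst h
      rw [← neg_one_smul k]
      refine Equivariant.smul _ (equivariant_cur_average HS ?_)
      exact hE.cur (scale_x hω t) (by rw [pow_one]; field_simp) ht
    · exact equivariant_zero

end Taft

end BarCochain

namespace BarCochain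

/-! ### Normal cocycles and their internal degrees. -/

section NormalForm

open TaftAlgebra

variable {k : Type*} [Field k] {n : ℕ} {ω : k} {hω : IsPrimitiveRoot ω n}
  {M : Type*} [AddCommGroup M] [Module k M]
  {L R : TaftAlgebra hω →ₗ[k] M →ₗ[k] M} {τ : M →ₗ[k] M} {m : ℕ} {t : k} [NeZero n]

/-- A normalized cocycle is built from its value at x by the cocycle identity at (x, x ^ j), and
each step of that recursion respects degrees. -/
theorem GNormal.equivariant (HS : IsSemilinear L R (scale hω t) τ)
    (ht : t ≠ 0) {f : BarCochain k (TaftAlgebra hω) M (m + 1)} (hf : GNormal L f)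
    (hd : BarCochain.d L R (m + 1) f = 0) {c : k}
    (hx : Equivariant (scale hω t) τ (c * t⁻¹) (BarCochain.cur f (x hω))) :
    Equivariant (scale hω t) τ c f := by
  refine equivariant_of_gLinear HS ht hf.g_mul fun j hj => ?_
  clear hj
  induction j with
  | zero => rw [pow_zero, pow_zero, hf.one]; exact equivariant_zero
  | succ j ih =>
    have h1 := cur_dRight_cur hd (x hω) (x hω ^ j)
    have h2 : BarCochain.cur f (x hω ^ (j + 1)) = BarCochain.lact L (x hω)
        (BarCochain.cur f (x hω ^ j))
        - BarCochain.cur (dRight R m (BarCochain.cur f (x hω))) (x hω ^ j) := by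
      rw [h1, pow_succ', sub_sub_cancel]
    rw [h2]
    refine Equivariant.sub (ih.lact HS (scale_x hω t) ?_) ?_
    · rw [pow_succ]; field_simp
    -- `dRight` is the differential for the zero left action, so the homogeneity of differentials
    -- applies to it.
    · have HS0 : IsSemilinear 0 R (scale hω t) τ := ⟨by simp, HS.right⟩
      refine Equivariant.cur (Equivariant.d HS0 hx) (scale_x_pow hω t j) ?_ (pow_ne_zero _ ht)
      rw [pow_succ, inv_pow]; field_simp

theorem equivariant_of_topCoeff (HS : IsSemilinear L R (scale hω t) τ) (ht : t ≠ 0)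
    {F : BarCochain k (TaftAlgebra hω) M (m + 1)} {φ : BarCochain k (TaftAlgebra hω) M m}
    (hF : ∀ b, cur F b = lact L (topCoeff hω b) φ) {c : k}
    (hφ : Equivariant (scale hω t) τ (c * (t⁻¹) ^ n) φ) :
    Equivariant (scale hω t) τ (c * t⁻¹) F := by
  rw [equivariant_iff_cur]
  intro b
  rw [hF, hF, pull_lact, hφ, topCoeff_scale, HS.push_lact, map_smul (lact L), LinearMap.smul_apply,
    map_smul (lact L _), smul_smul]
  congr 1
  obtain ⟨N, hN⟩ : ∃ N, N + 1 = n := ⟨n - 1, Nat.sub_add_cancel (NeZero.pos n)⟩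
  have e : t ^ (n - 1) * t⁻¹ ^ n = t⁻¹ := by
    rw [← hN, Nat.add_sub_cancel, pow_succ, ← mul_assoc, ← mul_pow, mul_inv_cancel₀ ht, one_pow,
      one_mul]
  rw [mul_left_comm, e]

/-- The internal degrees of the generators of the minimal resolution. -/
def weight (n : ℕ) : ℕ → ℕ
  | 0 => 0
  | 1 => 1
  | r + 2 => weight n r + n

/-- Lowering p or q by 2 takes n from both sides, so only p, q ≤ 1 matter. The case p = q = 1 reads
n + 1 < 2 n and is where n ≥ 2 is needed. -/
theorem weight_add_lt {n : ℕ} (hn : 2 ≤ n) :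
    ∀ p q, weight n (p + q + 1) < weight n (p + 1) + weight n (q + 1)
  | 0, 0 => by simp [weight]
  | 0, 1 => by simp [weight]
  | 1, 0 => by simp [weight]
  | 1, 1 => by simp [weight]; omega
  | p + 2, q => by
    have := weight_add_lt hn p q
    rw [show p + 2 + q + 1 = p + q + 1 + 2 by ring, show p + 2 + 1 = p + 1 + 2 by ring, weight,
      weight]
    omega
  | p, q + 2 => by
    have := weight_add_lt hn p q
    rw [show p + (q + 2) + 1 = p + q + 1 + 2 by ring, show q + 2 + 1 = q + 1 + 2 by ring, weight,
      weight]
    omega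

/-- Cochains that are obtained from a cochain of degree at most one by iterating the periodicity
`φ ↦ ζ ∪ φ`, with `ζ` the cocycle `(a, b) ↦ (a b) / x ^ n`. -/
def IsNormal (L R : TaftAlgebra hω →ₗ[k] M →ₗ[k] M) :
    ∀ r : ℕ, BarCochain k (TaftAlgebra hω) M r → Prop
  | 0, _ => True
  | 1, f => GNormal L f
  | r + 2, f => GNormal L f ∧ ∃ φ, d L R r φ = 0 ∧ IsNormal L R r φ ∧
      ∀ b, cur (cur f (x hω)) b = lact L (topCoeff hω b) φ

/-- A cochain of arity 0 has degree 0 because the coefficients are not scaled. The passage from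
arity 0 to arity 1 adds 1, and each period adds n. -/
theorem IsNormal.equivariant (HS : IsSemilinear L R (scale hω t) LinearMap.id) (ht : t ≠ 0) :
    ∀ (r : ℕ) {f : BarCochain k (TaftAlgebra hω) M r}, d L R r f = 0 → IsNormal L R r f →
      Equivariant (scale hω t) LinearMap.id (t ^ weight n r) f
  | 0, f, _, _ => by
    rw [Equivariant, pull_zero_arity, weight, pow_zero, one_smul]
    rfl
  | 1, f, hd, hf => by
    refine GNormal.equivariant HS ht hf hd ?_
    rw [Equivariant, pull_zero_arity, weight, pow_one, mul_inv_cancel₀ ht, one_smul]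
    rfl
  | r + 2, f, hd, ⟨hf, φ, hφd, hφ, h⟩ => by
    refine GNormal.equivariant HS ht hf hd (equivariant_of_topCoeff HS ht h ?_)
    rw [weight, pow_add, mul_assoc, ← mul_pow, mul_inv_cancel₀ ht, one_pow, mul_one]
    exact IsNormal.equivariant HS ht r hφd hφ

/-- The factor φ is recovered by evaluating f at x and then at x ^ (n - 1), n factors x in all. -/
theorem equivariant_topCoeff_factor (HB : IsBimodule L R) (ht : t ≠ 0)
    {f : BarCochain k (TaftAlgebra hω) M (m + 2)} {φ : BarCochain k (TaftAlgebra hω) M m}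
    (h : ∀ b, cur (cur f (x hω)) b = lact L (topCoeff hω b) φ) {c : k}
    (hf : Equivariant (scale hω t) τ c f) : Equivariant (scale hω t) τ (c * (t⁻¹) ^ n) φ := by
  have hn := NeZero.pos n
  have e : φ = cur (cur f (x hω)) (x hω ^ (n - 1)) := by
    rw [h, topCoeff_x_pow hω (by omega), if_pos (by omega), HB.lact_one]
  rw [e]
  refine Equivariant.cur (c := c * t⁻¹) ?_ (scale_x_pow hω t (n - 1)) ?_ (pow_ne_zero _ ht)
  · exact hf.cur (scale_x hω t) (by field_simp) ht
  · obtain ⟨N, hN⟩ : ∃ N, N + 1 = n := ⟨n - 1, Nat.sub_add_cancel hn⟩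
    rw [← hN, Nat.add_sub_cancel, pow_succ, inv_pow]
    field_simp

/-- Passing from f to φ lowers both D and the weight by n, so the excess of D persists. At the
bottom it becomes a value v = t ^ D • τ v with D > 0, excluded by `hτ`; for the coefficients A this
means that no element has negative degree. -/
theorem IsNormal.eq_zero (HB : IsBimodule L R) (ht : t ≠ 0)
    (hτ : ∀ D v, 0 < D → v = t ^ D • τ v → v = 0) :
    ∀ (r : ℕ) {f : BarCochain k (TaftAlgebra hω) M r} (D : ℕ), d L R r f = 0 → IsNormal L R r f →
      weight n r < D → Equivariant (scale hω t) τ (t ^ D) f → f = 0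
  | 0, f, D, _, _, hD, h => by
    rw [Equivariant, pull_zero_arity] at h
    ext v
    exact hτ D _ hD (congrArg (fun ψ => ψ v) h)
  | 1, f, D, hd, hf, hD, h => by
    rw [weight] at hD
    refine GNormal.eq_zero hf hd ?_
    have h1 : Equivariant (scale hω t) τ (t ^ (D - 1)) (cur f (x hω)) :=
      h.cur (scale_x hω t) (by rw [← pow_succ', Nat.sub_add_cancel (by omega)]) ht
    rw [Equivariant, pull_zero_arity] at h1
    ext v
    exact hτ (D - 1) _ (by omega) (congrArg (fun ψ => ψ v) h1)
  | r + 2, f, D, hd, ⟨hf, φ, hφd, hφ, h⟩, hD, hE => by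
    rw [weight] at hD
    have h1 := equivariant_topCoeff_factor HB ht h hE
    have e : t ^ D * t⁻¹ ^ n = t ^ (D - n) := by
      rw [pow_sub₀ _ ht (by omega), inv_pow]
    rw [e] at h1
    have h2 := IsNormal.eq_zero HB ht hτ r (D - n) hφd hφ (by omega) h1
    refine hf.eq_zero hd (cur_ext fun b => ?_)
    rw [h, h2, map_zero, map_zero, LinearMap.zero_apply]

variable [CharZero k]

/-- Three corrections reduce f to its factor φ, which is then normalized recursively. The
quantifiers over t, τ and c come after h: the construction never refers to them, so a single h
inherits every homogeneity of f. -/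
theorem exists_isNormal_sub_d (HB : IsBimodule L R) (hn : 2 ≤ n) :
    ∀ (r : ℕ) {f : BarCochain k (TaftAlgebra hω) M (r + 1)}, d L R (r + 1) f = 0 →
      ∃ h : BarCochain k (TaftAlgebra hω) M r, IsNormal L R (r + 1) (f - d L R r h) ∧
        ∀ (t : k) (τ : M →ₗ[k] M) (c : k), t ≠ 0 → IsSemilinear L R (scale hω t) τ →
          Equivariant (scale hω t) τ c f → Equivariant (scale hω t) τ c h
  | 0, f, hf => by
    obtain ⟨h, h1, h2⟩ := exists_gNormal_sub_d HB hf
    exact ⟨h, h1, fun t τ c _ => h2 t τ c⟩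
  | r + 1, f, hf => by
    have step : ∀ {s : ℕ} {f : BarCochain k (TaftAlgebra hω) M (s + 2)}
        (h : BarCochain k (TaftAlgebra hω) M (s + 1)), d L R (s + 2) f = 0 →
        d L R (s + 2) (f - d L R (s + 1) h) = 0 := by
      intro s f h hf
      rw [map_sub, hf, HB.d_d, sub_zero]
    obtain ⟨h₁, n₁, e₁⟩ := exists_gNormal_sub_d HB hf
    have d₁ := step h₁ hf
    obtain ⟨h₂, n₂, g₂, o₂, e₂⟩ := exists_gNormal_second HB hn d₁ n₁
    have d₂ := step h₂ d₁
    obtain ⟨h₃, n₃, ⟨φ, hφ⟩, e₃⟩ := exists_gNormal_topCoeff HB hn g₂ o₂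
    have d₃ := step h₃ d₂
    have N₃ := (n₁.sub (n₂.d HB)).sub (n₃.d HB)
    have hdφ := d_eq_zero_of_topCoeff HB d₃ N₃ hφ
    have hsum : f - d L R (r + 1) h₁ - d L R (r + 1) h₂ - d L R (r + 1) h₃
        = f - d L R (r + 1) (h₁ + h₂ + h₃) := by
      rw [map_add, map_add]
      abel
    have E : ∀ (t : k) (τ : M →ₗ[k] M) (c : k), t ≠ 0 → IsSemilinear L R (scale hω t) τ →
        Equivariant (scale hω t) τ c f → Equivariant (scale hω t) τ c (h₁ + h₂ + h₃) := by
      intro t τ c ht HS hE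
      have E₁ := e₁ t τ c HS hE
      have F₁ := hE.sub (E₁.d HS)
      have E₂ := e₂ t τ c ht HS F₁
      exact (E₁.add E₂).add (e₃ t τ c ht HS (F₁.sub (E₂.d HS)))
    rw [hsum] at d₃ N₃ hφ
    -- For r = 0 the factor φ has arity 0 and is already normal. Otherwise its correction ψ is
    -- lifted through `carry`, which changes f (x, b) by `topCoeff` b times the differential of ψ.
    cases r with
    | zero => exact ⟨_, ⟨N₃, φ, hdφ, trivial, hφ⟩, E⟩
    | succ s =>
      obtain ⟨ψ, hψ, eψ⟩ := exists_isNormal_sub_d HB hn s hdφ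
      obtain ⟨h₄, n₄, hx, e₄⟩ := exists_gNormal_carry HB hn ψ
      refine ⟨h₁ + h₂ + h₃ + h₄, ⟨?_, φ - d L R s ψ, ?_, hψ, fun b => ?_⟩, ?_⟩
      · rw [map_add, ← sub_sub]
        exact N₃.sub (n₄.d HB)
      · rw [map_sub, hdφ, HB.d_d, sub_zero]
      · rw [map_add (d L R (s + 1 + 1)), ← sub_sub, map_sub cur, LinearMap.sub_apply, map_sub cur,
          LinearMap.sub_apply, hφ, hx, map_sub]
      · intro t τ c ht HS hE
        have E₃ := E t τ c ht HS hE
        have E₄ := equivariant_topCoeff_factor HB ht hφ (hE.sub (E₃.d HS))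
        exact E₃.add (e₄ t τ c ht HS (eψ t τ _ ht HS E₄))

/-- For n = 1 the relation x ^ n = 0 says x = 0, so a normalized cocycle vanishes at x and hence
everywhere. -/
theorem exists_eq_d_of_eq_one (HB : IsBimodule L R) (hn : n = 1)
    {f : BarCochain k (TaftAlgebra hω) M (m + 1)} (hf : d L R (m + 1) f = 0) :
    ∃ h, d L R m h = f := by
  obtain ⟨h, h1, -⟩ := exists_gNormal_sub_d HB hf
  refine ⟨h, (sub_eq_zero.1 (h1.eq_zero (R := R) ?_ ?_)).symm⟩
  · rw [map_sub, hf, HB.d_d, sub_zero]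
  · have : x hω = 0 := by
      have := x_pow_of_le hω (c := 1) hn.le
      rwa [pow_one] at this
    rw [this, map_zero]

end NormalForm

/-! ### The bracket adds internal degrees. -/

section Bracket

variable {k A : Type*} [Field k] [Ring A] [Algebra k A] {σ : A →ₐ[k] A}

theorem Equivariant.seq {M : Type*} [AddCommGroup M] [Module k M] {τ : M →ₗ[k] M} {c : k} {m : ℕ}
    {f : BarCochain k A M m} (hf : Equivariant σ τ c f) (a : ℕ → A) :
    f.seq (fun i => σ (a i)) = c • τ (f.seq a) :=
  congrArg (fun ψ => ψ fun i => a i) hf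

theorem equivariant_of_seq {M : Type*} [AddCommGroup M] [Module k M] {τ : M →ₗ[k] M} {c : k}
    {m : ℕ} {f : BarCochain k A M m} (hf : ∀ a, f.seq (fun i => σ (a i)) = c • τ (f.seq a)) :
    Equivariant σ τ c f :=
  ext_seq hf

/-- In each insertion c' leaves the inner slot by multilinearity, and the σ that stays there is what
the homogeneity of f requires. -/
theorem Equivariant.circ {m n : ℕ} {f : BarCochain k A A (m + 1)} {g : BarCochain k A A n}
    {c c' : k} (hf : Equivariant σ σ.toLinearMap c f) (hg : Equivariant σ σ.toLinearMap c' g) :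
    Equivariant σ σ.toLinearMap (c * c') (circ f g) := by
  refine equivariant_of_seq fun a => ?_
  rw [circ_seq, circ_seq, map_sum, Finset.smul_sum]
  refine Finset.sum_congr rfl fun i hi => ?_
  have h1 : shSeq i (fun i => σ (a i)) = fun j => σ (shSeq i a j) := rfl
  have h2 : insSeq i n (σ (g.seq (shSeq i a))) (fun i => σ (a i))
      = fun j => σ (insSeq i n (g.seq (shSeq i a)) a j) := by
    funext j
    simp only [insSeq]
    split_ifs <;> rfl
  rw [h1, hg.seq, seq_insSeq_smul f (Finset.mem_range.1 hi), AlgHom.toLinearMap_apply, h2, hf.seq,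
    map_smul, smul_smul, smul_smul, smul_smul]
  congr 1
  ring

theorem Equivariant.bracket {m n : ℕ} {f : BarCochain k A A (m + 1)}
    {g : BarCochain k A A (n + 1)} {c c' : k} (hf : Equivariant σ σ.toLinearMap c f)
    (hg : Equivariant σ σ.toLinearMap c' g) :
    Equivariant σ σ.toLinearMap (c * c') (bracket f g) := by
  refine equivariant_of_seq fun a => ?_
  rw [bracket_seq, bracket_seq, (hf.circ hg).seq, (hg.circ hf).seq, map_sub, map_smul, smul_sub,
    smul_comm (c * c'), mul_comm c']

theorem isBimodule_mul : IsBimodule (LinearMap.mul k A) (LinearMap.mul k A).flip :=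
  ⟨fun m => one_mul m, fun a b m => mul_assoc a b m, fun a b m => (mul_assoc a m b).symm,
    fun a b m => (mul_assoc m a b).symm⟩

theorem isSemilinear_mul (σ : A →ₐ[k] A) :
    IsSemilinear (LinearMap.mul k A) (LinearMap.mul k A).flip σ σ.toLinearMap :=
  ⟨fun a m => map_mul σ a m, fun a m => map_mul σ m a⟩

end Bracket

/-! ### The embedding of Hopf algebra cohomology preserves internal degrees. -/

section Hopf

variable {k A : Type*} [Field k] [Ring A] [HopfAlgebra k A] {σ : A →ₐ[k] A}

open Coalgebra

theorem isBimodule_trivialAction : IsBimodule (trivialAction k A k) (trivialAction k A k) := by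
  constructor <;> intros <;> simp [trivialAction, mul_assoc, mul_left_comm]

theorem isSemilinear_trivialAction (h : ∀ a, counit (R := k) (σ a) = counit (R := k) a) :
    IsSemilinear (trivialAction k A k) (trivialAction k A k) σ LinearMap.id := by
  constructor <;> intros <;> simp [trivialAction, h]

theorem Equivariant.unitMap {c : k} {m : ℕ} {f : BarCochain k A k m}
    (hf : Equivariant σ LinearMap.id c f) :
    Equivariant σ σ.toLinearMap c (unitMap k A m f) := by
  ext a
  have h : f (fun i => σ (a i)) = c • f a := congrArg (fun ψ => ψ a) hf
  change algebraMap k A (f fun i => σ (a i)) = c • σ (algebraMap k A (f a))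
  rw [h, AlgHom.commutes, smul_eq_mul, map_mul, Algebra.smul_def]

/-- The map uses only the coproduct and the product of A, with which σ commutes, so the factor c of
f is the only one. The comparison is made on pure tensors before the coproduct is inserted. -/
theorem Equivariant.adToHochschild {c : k} {m : ℕ} {f : BarCochain k A A m}
    (hσ : ∀ a, comul (R := k) (σ a)
      = TensorProduct.map σ.toLinearMap σ.toLinearMap (comul (R := k) a))
    (hf : Equivariant σ σ.toLinearMap c f) :
    Equivariant σ σ.toLinearMap c (adToHochschild k A m f) := by
  have key : ((LinearMap.mul' k A).compMultilinearMap
      (tensor m f (MultilinearMap.mkPiAlgebraFin k m A))).compLinearMap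
        (fun _ => TensorProduct.map σ.toLinearMap σ.toLinearMap)
      = c • σ.toLinearMap.compMultilinearMap ((LinearMap.mul' k A).compMultilinearMap
          (tensor m f (MultilinearMap.mkPiAlgebraFin k m A))) := by
    apply ext_tmul
    intro a b
    have h : f (fun i => σ (a i)) = c • σ (f a) := congrArg (fun ψ => ψ a) hf
    simp only [MultilinearMap.compLinearMap_apply, LinearMap.compMultilinearMap_apply,
      TensorProduct.map_tmul, AlgHom.toLinearMap_apply, tensor_tmul, smul_apply,
      LinearMap.mul'_apply, MultilinearMap.mkPiAlgebraFin_apply, map_mul, h, map_list_prod,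
      List.map_ofFn, smul_mul_assoc]
    rfl
  ext a
  have := congrArg (fun ψ => ψ fun i => comul (R := k) (a i)) key
  simp only [MultilinearMap.compLinearMap_apply, ← hσ] at this
  exact this

end Hopf

end BarCochain

/-! ### Scaling and the coalgebra structure; degrees of elements. -/

namespace TaftAlgebra

variable {k : Type*} [Field k] {n : ℕ} [NeZero n] {ω : k} (hω : IsPrimitiveRoot ω n)

theorem comul_scale (t : k) (a : TaftAlgebra hω) :
    Coalgebra.comul (R := k) (scale hω t a)
      = TensorProduct.map (scale hω t).toLinearMap (scale hω t).toLinearMap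
        (Coalgebra.comul (R := k) a) := by
  have key : (comulHom hω).comp (scale hω t)
      = (Algebra.TensorProduct.map (scale hω t) (scale hω t)).comp (comulHom hω) := by
    apply algHom_ext
    · simp [comulHom, TensorProduct.smul_tmul']
    · simp [comulHom]
  exact DFunLike.congr_fun key a

theorem counit_scale (t : k) (a : TaftAlgebra hω) :
    Coalgebra.counit (R := k) (scale hω t a) = Coalgebra.counit (R := k) a := by
  have key : (counitHom hω).comp (scale hω t) = counitHom hω := by
    apply algHom_ext
    · simp [counitHom]
    · simp [counitHom]
  exact DFunLike.congr_fun key a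

/-- The eigenvalues of `scale` are powers of `t` with nonnegative exponent. -/
theorem eq_zero_of_eq_pow_smul_scale {t : k} (ht : ∀ j, 0 < j → t ^ j ≠ 1) {D : ℕ} (hD : 0 < D)
    {a : TaftAlgebra hω} (ha : a = t ^ D • scale hω t a) : a = 0 := by
  have hg : (LinearMap.mulLeft k (g hω) : Module.End k (TaftAlgebra hω)) ^ n = 1 := by
    simpa using pow_mulLeft_g hω 1 (one_pow n)
  -- A left inverse of 1 - t ^ D σ_t. That operator multiplies x ^ c by 1 - t ^ (D + c), which is
  -- nonzero since D + c > 0.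
  obtain ⟨E, h1, h2⟩ := exists_gLinear hω _ hg fun c => (1 - t ^ (D + c))⁻¹ • x hω ^ c
  have key : E ∘ₗ (LinearMap.id - t ^ D • (scale hω t).toLinearMap) = LinearMap.id := by
    refine gLinear_ext hω (LinearMap.mulLeft k (g hω)) ?_ (fun _ => rfl) fun c hc => ?_
    · intro b
      simp only [LinearMap.comp_apply, LinearMap.sub_apply, LinearMap.id_apply,
        LinearMap.smul_apply, AlgHom.toLinearMap_apply, map_mul, scale_g, ← mul_smul_comm,
        ← mul_sub, h1]
    · simp only [LinearMap.comp_apply, LinearMap.sub_apply, LinearMap.id_apply,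
        LinearMap.smul_apply, AlgHom.toLinearMap_apply, scale_x_pow, smul_smul, ← pow_add]
      have h3 : x hω ^ c - t ^ (D + c) • x hω ^ c = (1 - t ^ (D + c)) • x hω ^ c := by
        rw [sub_smul, one_smul]
      rw [h3, map_smul, h2 c hc, smul_smul,
        mul_inv_cancel₀ (sub_ne_zero.2 (ht _ (by omega)).symm), one_smul]
  have h := LinearMap.congr_fun key a
  simp only [LinearMap.comp_apply, LinearMap.sub_apply, LinearMap.id_apply,
    LinearMap.smul_apply, AlgHom.toLinearMap_apply] at h
  rw [← ha, sub_self, map_zero] at h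
  exact h.symm

end TaftAlgebra

/-! ### Vanishing by comparison of degrees. -/

section Main

open BarCochain TaftAlgebra

variable {k : Type*} [Field k] [CharZero k] {n : ℕ} [NeZero n] {ω : k}
  {hω : IsPrimitiveRoot ω n}

/-- Justifies the choice t = 2 of the scaling parameter: in characteristic 0 it is not a root of
unity. -/
theorem two_pow_ne_one (j : ℕ) (hj : 0 < j) : (2 : k) ^ j ≠ 1 := by
  have : (2 : ℕ) ^ j ≠ 1 := (Nat.one_lt_two_pow hj.ne').ne'
  exact_mod_cast this

/-- For `n = 1` the cohomology of the Taft algebra vanishes in positive degrees. -/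
theorem hopfCohomology_eq_zero_of_eq_one (hn : n = 1) {p : ℕ}
    (α : HopfCohomology k (TaftAlgebra hω) (p + 1)) : α = 0 := by
  obtain ⟨f, rfl⟩ := Submodule.Quotient.mk_surjective _ α
  obtain ⟨h, hh⟩ := exists_eq_d_of_eq_one isBimodule_trivialAction hn f.2
  exact (Submodule.Quotient.mk_eq_zero _).2 ⟨h, hh⟩

/-- Cohomology classes of the Taft algebra have homogeneous representatives. -/
theorem exists_equivariant_representative (hn : 2 ≤ n) {p : ℕ}
    (α : HopfCohomology k (TaftAlgebra hω) (p + 1)) :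
    ∃ f, α = Submodule.Quotient.mk f ∧
      Equivariant (scale hω 2) LinearMap.id (2 ^ weight n (p + 1)) f.1 := by
  obtain ⟨f, rfl⟩ := Submodule.Quotient.mk_surjective _ α
  obtain ⟨h, h1, -⟩ := exists_isNormal_sub_d isBimodule_trivialAction hn p f.2
  have hd : d (trivialAction k (TaftAlgebra hω) k) (trivialAction k (TaftAlgebra hω) k) (p + 1)
      (f.1 - d (trivialAction k (TaftAlgebra hω) k)
      (trivialAction k (TaftAlgebra hω) k) p h) = 0 := by
    rw [map_sub, isBimodule_trivialAction.d_d, sub_zero]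
    exact f.2
  refine ⟨⟨_, hd⟩, ?_, h1.equivariant
    (isSemilinear_trivialAction (counit_scale hω 2)) two_ne_zero _ hd⟩
  refine (Submodule.Quotient.eq _).2 ⟨h, ?_⟩
  simp

/-- There is no Hochschild cohomology of the Taft algebra in internal degrees below `-weight`. -/
theorem mem_range_dH_of_equivariant (hn : 2 ≤ n) {r D : ℕ} (hD : weight n (r + 1) < D)
    {f : BarCochain k (TaftAlgebra hω) (TaftAlgebra hω) (r + 1)}
    (hf : dH k (TaftAlgebra hω) (r + 1) f = 0)
    (hE : Equivariant (scale hω 2) (scale hω 2).toLinearMap (2 ^ D) f) :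
    f ∈ LinearMap.range (dH k (TaftAlgebra hω) r) := by
  obtain ⟨h, h1, h2⟩ := exists_isNormal_sub_d isBimodule_mul hn r hf
  have hS := isSemilinear_mul (scale hω 2)
  have h0 := h1.eq_zero isBimodule_mul two_ne_zero
    (fun D v hD hv => eq_zero_of_eq_pow_smul_scale hω two_pow_ne_one hD hv) _ D
    (by rw [map_sub, hf, isBimodule_mul.d_d, sub_zero]) hD
    (hE.sub ((h2 2 _ _ two_ne_zero hS hE).d hS))
  exact ⟨h, (sub_eq_zero.1 h0).symm⟩

end Main

theorem theorem5p1 {k : Type*} [Field k] [CharZero k] {n : ℕ} [NeZero n] {ω : k}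
    (hω : IsPrimitiveRoot ω n) (p q : ℕ)
    (α : HopfCohomology k (TaftAlgebra hω) (p + 1))
    (β : HopfCohomology k (TaftAlgebra hω) (q + 1)) :
    gerstenhaberBracket k (TaftAlgebra hω) p q
      (hopfToHochschild k (TaftAlgebra hω) (p + 1) α)
      (hopfToHochschild k (TaftAlgebra hω) (q + 1) β) = 0 := by
  -- For n = 1 the weight inequality fails at p = q = 1, so this case rests on the vanishing of the
  -- cohomology.
  by_cases hn : n = 1
  · rw [hopfCohomology_eq_zero_of_eq_one hn α, map_zero, map_zero, LinearMap.zero_apply]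
  · have hn2 : 2 ≤ n := by
      have := NeZero.pos n
      omega
    obtain ⟨f, rfl, hf⟩ := exists_equivariant_representative hn2 α
    obtain ⟨g, rfl, hg⟩ := exists_equivariant_representative hn2 β
    have hσ := TaftAlgebra.comul_scale hω 2
    have hE := (hf.unitMap.adToHochschild hσ).bracket (hg.unitMap.adToHochschild hσ)
    rw [← pow_add] at hE
    have hcocycle : ∀ {r : ℕ} (u : BarCochain.cocycles (BarCochain.trivialAction k _ k)
        (BarCochain.trivialAction k _ k) r), BarCochain.dH k (TaftAlgebra hω) r
          (BarCochain.adToHochschild k _ r (BarCochain.unitMap k _ r u.1)) = 0 := by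
      intro r u
      have hu : BarCochain.d _ _ r u.1 = 0 := u.2
      rw [BarCochain.dH, BarCochain.adToHochschild_d, BarCochain.unitMap_d, hu, map_zero, map_zero]
    -- The bracket of the homogeneous representatives is a cocycle of degree `weight n (p + 1) +
    -- weight n (q + 1)`, too large for its arity.
    exact (Submodule.Quotient.mk_eq_zero _).2
      (mem_range_dH_of_equivariant hn2 (BarCochain.weight_add_lt hn2 p q)
        (BarCochain.bracket_mem_cocycles (hcocycle f) (hcocycle g)) hE)
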